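/- A (realtime) one-counter automaton (OCA) is a tuple $\mathcal A=(Q,\Sigma,\Delta,q_0,F)$ with a finite set of states $Q$, a finite alphabet $\Sigma$, an initial state $q_0\in Q$, a set $F\subseteq Q$ of final states and a set of transitions $\Delta\subseteq Q\times\{\mathrm{zero},\neg\mathrm{zero}\}\times\Sigma\times\{-1,0,1\}\times Q$. Its configurations are the pairs $(q,m)\in Q\times\mathbb N$. On reading $a\in\Sigma$ in the configuration $(q,m)$ it can take a transition $(q,z,a,d,q')\in\Delta$ such that $m+d\ge 0$ and such that $z=\mathrm{zero}$ if $m=0$ and $z=\neg\mathrm{zero}$ if $m>0$; this leads to the configuration $(q',m+d)$. A word $w\in\Sigma^*$ is accepted if some run over $w$ from $(q_0,0)$ ends in a configuration whose state is in $F$; $\mathcal L(\mathcal A)$ is the set of accepted words. The letter game on $\mathcal A$ is played by Adam and Eve on positions $(c,w)$, where $c$ is a configuration and $w\in\Sigma^*$, starting from $((q_0,0),\varepsilon)$. In the position $(c,w)$ Adam chooses a letter $a\in\Sigma$, and Eve then chooses a transition that can be taken from $c$ on reading $a$, leading to a configuration $c'$. If Eve has no transition to choose, then the play ends, and she loses if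 $wa$ is a prefix of a word in $\mathcal L(\mathcal A)$ and wins otherwise. If $wa\in\mathcal L(\mathcal A)$ and the state of $c'$ is not in $F$, then Adam wins and the play ends. Otherwise the play continues from $(c',wa)$. Eve wins every infinite play. The automaton $\mathcal A$ is history-deterministic if Eve has a winning strategy in the letter game on $\mathcal A$. **Theorem.** The following problem is undecidable: given (a finite description of) a one-counter automaton $\mathcal A$, is $\mathcal A$ history-deterministic? That is, no algorithm decides, for every one-counter automaton $\mathcal A$, whether $\mathcal A$ is history-deterministic. -/

import Mathlib

/-- A (realtime) one-counter automaton with set of states `Q` and alphabet `A` (both are finite in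
all uses below). A transition is a tuple `(q, z, a, d, q')`, where the test `z` is `true` for
"zero" and `false` for "not zero", and `d` is one of `-1, 0, 1`. -/
structure OCA (Q A : Type) where
  /-- the transition relation `Δ` -/
  trans : Set (Q × Bool × A × SignType × Q)
  /-- the initial state -/
  init : Q
  /-- the set of final states -/
  final : Set Q

namespace OCA

variable {Q A : Type}

/-- `M.Step c a c'`: in the configuration `c = (q, m)`, some transition of `M` reading `a` can be
taken, and it leads to `c'`. Zero transitions are available exactly when `m = 0`, nonzero
transitions exactly when `m > 0`, and the counter stays a natural number. The transition taken is
determined by `c`, `a` and `c'`. -/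
def Step (M : OCA Q A) (c : Q × ℕ) (a : A) (c' : Q × ℕ) : Prop :=
  ∃ d : SignType, (c.1, decide (c.2 = 0), a, d, c'.1) ∈ M.trans ∧ (c'.2 : ℤ) = (c.2 : ℤ) + (d : ℤ)

/-- `M.Run c w c'`: there is a run of `M` over the word `w` from `c` to `c'`. -/
inductive Run (M : OCA Q A) : Q × ℕ → List A → Q × ℕ → Prop
  | nil (c : Q × ℕ) : Run M c [] c
  | cons {c c' c'' : Q × ℕ} {a : A} {w : List A} :
      M.Step c a c' → Run M c' w c'' → Run M c (a :: w) c''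

/-- The language of `M`: the words with a run from the initial state with counter value `0` to
a configuration with a final state. -/
def language (M : OCA Q A) : Language A :=
  {w | ∃ c : Q × ℕ, M.Run (M.init, 0) w c ∧ c.1 ∈ M.final}

/-- A strategy of the second player (Eve) in the letter game: in the position `(c, w)`, after the
first player (Adam) has chosen the letter `a`, she moves to the configuration `σ c w a`. -/
abbrev Strategy (Q A : Type) : Type := Q × ℕ → List A → A → Q × ℕ

/-- `M.Consistent σ c w`: the position `(c, w)` of the letter game on `M` occurs in a play, from
the initial position, in which Eve plays according to `σ`. -/
inductive Consistent (M : OCA Q A) (σ : Strategy Q A) : Q × ℕ → List A → Prop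
  | init : Consistent M σ (M.init, 0) []
  | step {c : Q × ℕ} {w : List A} (a : A) :
      Consistent M σ c w → M.Step c a (σ c w a) → Consistent M σ (σ c w a) (w ++ [a])

/-- `σ` is a winning strategy of Eve in the letter game on `M` (a resolver). For every position
`(c, w)` that is met when she plays `σ`, and every letter `a` that Adam then chooses:
* if some transition can be taken, then `σ` takes one;
* if no transition can be taken, then `w a` is not a prefix of an accepted word;
* if Eve moves to `c'` and `w a` is accepted by `M`, then `c'` has a final state. -/
def IsResolver (M : OCA Q A) (σ : Strategy Q A) : Prop :=
  ∀ (c : Q × ℕ) (w : List A) (a : A), M.Consistent σ c w →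
    ((∃ c', M.Step c a c') → M.Step c a (σ c w a)) ∧
    ((¬ ∃ c', M.Step c a c') → ¬ ∃ v : List A, w ++ [a] ++ v ∈ M.language) ∧
    (M.Step c a (σ c w a) → w ++ [a] ∈ M.language → (σ c w a).1 ∈ M.final)

/-- `M` is history-deterministic: Eve wins the letter game on `M`. -/
def HistoryDeterministic (M : OCA Q A) : Prop :=
  ∃ σ : Strategy Q A, M.IsResolver σ

end OCA

instance SignType.instPrimcodable : Primcodable SignType :=
  Primcodable.ofEquiv (Fin 3) SignType.fin3Equiv.toEquiv

/-- A finite description of a one-counter automaton, the form in which it is given to an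
algorithm: its states are `0, …, maxState`, its letters are the numbers below `numLetters`, its
transitions and final states are listed. -/
structure OCACode where
  maxState : ℕ
  numLetters : ℕ
  trans : List (ℕ × Bool × ℕ × SignType × ℕ)
  init : ℕ
  final : List ℕ

namespace OCACode

/-- A description is a tuple of numbers and lists. -/
def equivProd :
    OCACode ≃ ℕ × ℕ × List (ℕ × Bool × ℕ × SignType × ℕ) × ℕ × List ℕ where
  toFun d := (d.maxState, d.numLetters, d.trans, d.init, d.final)
  invFun t := ⟨t.1, t.2.1, t.2.2.1, t.2.2.2.1, t.2.2.2.2⟩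
  left_inv _ := rfl
  right_inv _ := rfl

instance instPrimcodable : Primcodable OCACode :=
  Primcodable.ofEquiv _ equivProd

/-- The automaton given by a description. List entries that mention a state or a letter out of
range have no effect, and the number of the initial state is read modulo the number of states, so
that every description gives an automaton. -/
def toOCA (d : OCACode) : OCA (Fin (d.maxState + 1)) (Fin d.numLetters) where
  trans := {t | ((t.1 : ℕ), t.2.1, (t.2.2.1 : ℕ), t.2.2.2.1, (t.2.2.2.2 : ℕ)) ∈ d.trans}
  init := Fin.ofNat (d.maxState + 1) d.init
  final := {q | (q : ℕ) ∈ d.final}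

/-- Every one-counter automaton with a finite set of states and a finite alphabet has, up to the
names of its states and letters, a description. -/
theorem exists_toOCA_eq (n k : ℕ) (M : OCA (Fin (n + 1)) (Fin k)) :
    ∃ (T : List (ℕ × Bool × ℕ × SignType × ℕ)) (i : ℕ) (F : List ℕ),
      (OCACode.mk n k T i F).toOCA = M := by
  classical
  refine ⟨(M.trans.toFinite.toFinset.toList).map
      (fun t => ((t.1 : ℕ), t.2.1, (t.2.2.1 : ℕ), t.2.2.2.1, (t.2.2.2.2 : ℕ))), M.init,
      M.final.toFinite.toFinset.toList.map Fin.val, ?_⟩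
  obtain ⟨tr, q₀, F⟩ := M
  have h1 : ∀ q : Fin (n + 1), Fin.ofNat (n + 1) (q : ℕ) = q := fun q => by
    ext; simp [Fin.ofNat, Nat.mod_eq_of_lt q.isLt]
  simp only [toOCA, OCA.mk.injEq]
  refine ⟨?_, h1 q₀, ?_⟩
  · ext ⟨p, z, a, d, q⟩
    simp only [Set.mem_ofPred_eq, List.mem_map, Finset.mem_toList, Set.Finite.mem_toFinset,
      Prod.mk.injEq, Prod.exists]
    constructor
    · rintro ⟨p', z', a', d', q', h, hp, rfl, ha, rfl, hq⟩
      rwa [← Fin.ext hp, ← Fin.ext ha, ← Fin.ext hq]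
    · intro h
      exact ⟨p, z, a, d, q, h, rfl, rfl, rfl, rfl, rfl⟩
  · ext q
    simp only [Set.mem_ofPred_eq, List.mem_map, Finset.mem_toList, Set.Finite.mem_toFinset]
    constructor
    · rintro ⟨q', h, hq⟩
      rwa [← Fin.ext hq]
    · intro h
      exact ⟨q, h, rfl⟩

end OCACode

/-! The complement of the halting problem reduces to history-determinism. Halting of a code `c` on
input 0 is expressed by one fixed program for two counters, which can be executed from `(b ^ encode
c, 0)` iff `c` halts (`exists_two_counter_program_halting`). Programs are regular expressions over
counter operations, so a fixed DFA `M` accepts exactly the operation sequences that the program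
allows.

A sequence of operations is executable iff it is executable for each counter separately
(`exec_iff_trackWord`), and a single counter can check one of the two. The automaton `gameCode M j`
has its only nondeterminism at the first letter, 6. One branch, the control, accepts the words that
consist of `j + 1` increments and a word of `M`, and respect the first counter. The other branch,
state 1, accepts once the second counter is violated or a letter that is no operation occurs.

Eve must choose state 1: the control has no move on the letter 7, although the word 6 7 is accepted
through state 1. This choice wins unless the control accepts a word that state 1 rejects. Such a
word respects both counters, so it is an execution of the program from `(j + 1, 0)`. With `j + 1 = b
^ encode c`, Eve wins iff `c` does not halt (`historyDeterministic_gameOCA`,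
`not_historyDeterministic_gameOCA`). -/

/-! ### Counter operations. -/

/-- The operations of a counter machine whose counters are indexed by `ι`: increment, decrement
(possible if the counter is positive), and test for zero. -/
inductive CounterOp (ι : Type) where
  | inc (i : ι)
  | dec (i : ι)
  | zero (i : ι)

namespace CounterOp

variable {ι : Type}

section
variable [DecidableEq ι]

/-- The effect of an operation on the valuation of the counters. -/
def Rel : CounterOp ι → (ι → ℕ) → (ι → ℕ) → Prop
  | inc i, x, y => y = x + Pi.single i 1
  | dec i, x, y => x = y + Pi.single i 1
  | zero i, x, y => x i = 0 ∧ y = x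

/-- The effect of a sequence of operations. -/
def Exec : List (CounterOp ι) → (ι → ℕ) → (ι → ℕ) → Prop
  | [], x, y => x = y
  | a :: w, x, y => ∃ z, a.Rel x z ∧ Exec w z y

theorem exec_append (u v : List (CounterOp ι)) (x y : ι → ℕ) :
    Exec (u ++ v) x y ↔ ∃ z, Exec u x z ∧ Exec v z y := by
  induction u generalizing x with
  | nil => simp [Exec]
  | cons a u ih =>
    simp only [List.cons_append, Exec, ih]
    constructor
    · rintro ⟨z, h, z', h1, h2⟩
      exact ⟨z', ⟨z, h, h1⟩, h2⟩
    · rintro ⟨z', ⟨z, h, h1⟩, h2⟩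
      exact ⟨z, h, z', h1, h2⟩

end

end CounterOp

/-! ### Regular expressions as nondeterministic counter programs. -/

namespace RegularExpression

open Computability

/-- Substitution of regular expressions for the letters of a regular expression. -/
def subst {α β : Type*} (f : α → RegularExpression β) : RegularExpression α → RegularExpression β
  | 0 => 0
  | 1 => 1
  | char a => f a
  | P + Q => P.subst f + Q.subst f
  | P * Q => P.subst f * Q.subst f
  | star P => star (P.subst f)

section CounterPrograms

variable {ι : Type} [DecidableEq ι]

/-- A regular expression over counter operations, read as a nondeterministic counter program:
its effect is that of any of the sequences of operations that it matches. -/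
def Rel (P : RegularExpression (CounterOp ι)) (x y : ι → ℕ) : Prop :=
  ∃ w ∈ P.matches', CounterOp.Exec w x y

theorem rel_zero (x y : ι → ℕ) : ¬ Rel 0 x y := by
  rintro ⟨w, hw, -⟩
  exact hw

theorem rel_one (x y : ι → ℕ) : Rel 1 x y ↔ x = y := by
  simp [Rel, Language.mem_one, CounterOp.Exec]

theorem rel_char (a : CounterOp ι) (x y : ι → ℕ) : Rel (char a) x y ↔ a.Rel x y := by
  constructor
  · rintro ⟨w, rfl, z, h, rfl⟩
    exact h
  · exact fun h => ⟨[a], rfl, y, h, rfl⟩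

theorem rel_add (P Q : RegularExpression (CounterOp ι)) (x y : ι → ℕ) :
    Rel (P + Q) x y ↔ Rel P x y ∨ Rel Q x y := by
  simp only [Rel, matches'_add, Language.mem_add, or_and_right, exists_or]

theorem rel_mul (P Q : RegularExpression (CounterOp ι)) (x y : ι → ℕ) :
    Rel (P * Q) x y ↔ ∃ z, Rel P x z ∧ Rel Q z y := by
  constructor
  · rintro ⟨w, ⟨u, hu, v, hv, rfl⟩, h⟩
    obtain ⟨z, h1, h2⟩ := (CounterOp.exec_append u v x y).1 h
    exact ⟨z, ⟨u, hu, h1⟩, v, hv, h2⟩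
  · rintro ⟨z, ⟨u, hu, h1⟩, v, hv, h2⟩
    exact ⟨u ++ v, ⟨u, hu, v, hv, rfl⟩, (CounterOp.exec_append u v x y).2 ⟨z, h1, h2⟩⟩

theorem rel_star (P : RegularExpression (CounterOp ι)) (x y : ι → ℕ) :
    Rel (star P) x y ↔ Relation.ReflTransGen (Rel P) x y := by
  constructor
  · rintro ⟨w, ⟨S, rfl, hS⟩, h⟩
    induction S generalizing x with
    | nil => obtain rfl : x = y := h; exact .refl
    | cons u S ih =>
      obtain ⟨z, h1, h2⟩ := (CounterOp.exec_append u S.flatten x y).1 h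
      exact .head ⟨u, hS u (by simp), h1⟩ (ih z (fun v hv => hS v (by simp [hv])) h2)
  · intro h
    induction h using Relation.ReflTransGen.head_induction_on with
    | refl => exact ⟨[], Language.nil_mem_kstar _, rfl⟩
    | head h1 _ ih =>
      obtain ⟨u, hu, h1⟩ := h1
      obtain ⟨w, ⟨S, rfl, hS⟩, h2⟩ := ih
      refine ⟨u ++ S.flatten, ⟨u :: S, rfl, ?_⟩, (CounterOp.exec_append _ _ _ _).2 ⟨_, h1, h2⟩⟩
      intro v hv
      rcases List.mem_cons.1 hv with rfl | hv
      exacts [hu, hS v hv]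

/-- Simulation of counter programs: if each operation is simulated in both directions, with
respect to the correspondence `R` of the valuations, then so is every program. -/
theorem subst_simulation {κ : Type} [DecidableEq κ]
    (f : CounterOp ι → RegularExpression (CounterOp κ)) (R : (ι → ℕ) → (κ → ℕ) → Prop)
    (forth : ∀ a x c, R x c → ∀ y, a.Rel x y → ∃ d, (f a).Rel c d ∧ R y d)
    (back : ∀ a x c, R x c → ∀ d, (f a).Rel c d → ∃ y, a.Rel x y ∧ R y d)
    (P : RegularExpression (CounterOp ι)) :
    ∀ x c, R x c →
      (∀ y, P.Rel x y → ∃ d, (P.subst f).Rel c d ∧ R y d) ∧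
      (∀ d, (P.subst f).Rel c d → ∃ y, P.Rel x y ∧ R y d) := by
  induction P with
  | zero =>
    exact fun x c _ => ⟨fun y h => (rel_zero _ _ h).elim, fun d h => (rel_zero _ _ h).elim⟩
  | epsilon =>
    refine fun x c hR => ⟨fun y h => ?_, fun d h => ?_⟩
    · obtain rfl := (rel_one _ _).1 h
      exact ⟨c, (rel_one _ _).2 rfl, hR⟩
    · obtain rfl := (rel_one _ _).1 h
      exact ⟨x, (rel_one _ _).2 rfl, hR⟩
  | char a =>
    refine fun x c hR => ⟨fun y h => forth a x c hR y ((rel_char _ _ _).1 h), fun d h => ?_⟩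
    obtain ⟨y, h1, h2⟩ := back a x c hR d h
    exact ⟨y, (rel_char _ _ _).2 h1, h2⟩
  | plus P Q ihP ihQ =>
    refine fun x c hR => ⟨fun y h => ?_, fun d h => ?_⟩
    · rcases (rel_add _ _ _ _).1 h with h | h
      · obtain ⟨d, h1, h2⟩ := (ihP x c hR).1 y h
        exact ⟨d, (rel_add _ _ _ _).2 (.inl h1), h2⟩
      · obtain ⟨d, h1, h2⟩ := (ihQ x c hR).1 y h
        exact ⟨d, (rel_add _ _ _ _).2 (.inr h1), h2⟩
    · rcases (rel_add _ _ _ _).1 h with h | h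
      · obtain ⟨y, h1, h2⟩ := (ihP x c hR).2 d h
        exact ⟨y, (rel_add _ _ _ _).2 (.inl h1), h2⟩
      · obtain ⟨y, h1, h2⟩ := (ihQ x c hR).2 d h
        exact ⟨y, (rel_add _ _ _ _).2 (.inr h1), h2⟩
  | comp P Q ihP ihQ =>
    refine fun x c hR => ⟨fun y h => ?_, fun d h => ?_⟩
    · obtain ⟨z, h1, h2⟩ := (rel_mul _ _ _ _).1 h
      obtain ⟨e, h3, h4⟩ := (ihP x c hR).1 z h1
      obtain ⟨d, h5, h6⟩ := (ihQ z e h4).1 y h2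
      exact ⟨d, (rel_mul _ _ _ _).2 ⟨e, h3, h5⟩, h6⟩
    · obtain ⟨e, h1, h2⟩ := (rel_mul _ _ _ _).1 h
      obtain ⟨z, h3, h4⟩ := (ihP x c hR).2 e h1
      obtain ⟨y, h5, h6⟩ := (ihQ z e h4).2 d h2
      exact ⟨y, (rel_mul _ _ _ _).2 ⟨z, h3, h5⟩, h6⟩
  | star P ih =>
    refine fun x c hR => ⟨fun y h => ?_, fun d h => ?_⟩
    · induction (rel_star _ _ _).1 h with
      | refl => exact ⟨c, (rel_star _ _ _).2 .refl, hR⟩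
      | @tail y z h0 h1 IH =>
        obtain ⟨d, h2, h3⟩ := IH ((rel_star _ _ _).2 h0)
        obtain ⟨e, h4, h5⟩ := (ih y d h3).1 z h1
        exact ⟨e, (rel_star _ _ _).2 (((rel_star _ _ _).1 h2).tail h4), h5⟩
    · induction (rel_star _ _ _).1 h with
      | refl => exact ⟨x, (rel_star _ _ _).2 .refl, hR⟩
      | @tail d e h0 h1 IH =>
        obtain ⟨y, h2, h3⟩ := IH ((rel_star _ _ _).2 h0)
        obtain ⟨z, h4, h5⟩ := (ih y d h3).2 e h1
        exact ⟨z, (rel_star _ _ _).2 (((rel_star _ _ _).1 h2).tail h4), h5⟩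

/-- `P` subtracts `u` from the counters, which is possible if none gets negative, and then
adds `v`. -/
def IsShift (P : RegularExpression (CounterOp ι)) (u v : ι → ℕ) : Prop :=
  ∀ x y, P.Rel x y ↔ ∃ r, x = r + u ∧ y = r + v

theorem isShift_one : IsShift (1 : RegularExpression (CounterOp ι)) 0 0 := by
  intro x y
  rw [rel_one]
  constructor
  · rintro rfl; exact ⟨x, by simp⟩
  · rintro ⟨r, rfl, rfl⟩; rfl

theorem isShift_inc (i : ι) : IsShift (char (CounterOp.inc i)) 0 (Pi.single i 1) := by
  intro x y
  rw [rel_char]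
  exact ⟨fun h => ⟨x, by simp, h⟩, fun ⟨r, h1, h2⟩ => by simpa [h1, CounterOp.Rel] using h2⟩

theorem isShift_dec (i : ι) : IsShift (char (CounterOp.dec i)) (Pi.single i 1) 0 := by
  intro x y
  rw [rel_char]
  exact ⟨fun h => ⟨y, h, by simp⟩, fun ⟨r, h1, h2⟩ => by simpa [h2, CounterOp.Rel] using h1⟩

theorem IsShift.mul_left {P Q : RegularExpression (CounterOp ι)} {u u' v : ι → ℕ}
    (hP : IsShift P u 0) (hQ : IsShift Q u' v) : IsShift (P * Q) (u + u') v := by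
  intro x y
  simp only [rel_mul, hP _ _, hQ _ _]
  constructor
  · rintro ⟨z, ⟨r, rfl, hz⟩, s, h, rfl⟩
    exact ⟨s, by rw [add_zero] at hz; rw [← hz, h]; abel, rfl⟩
  · rintro ⟨r, rfl, rfl⟩
    exact ⟨r + u', ⟨r + u', by abel, by simp⟩, r, rfl, rfl⟩

theorem IsShift.mul_right {P Q : RegularExpression (CounterOp ι)} {u v v' : ι → ℕ}
    (hP : IsShift P u v) (hQ : IsShift Q 0 v') : IsShift (P * Q) u (v + v') := by
  intro x y
  simp only [rel_mul, hP _ _, hQ _ _]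
  constructor
  · rintro ⟨z, ⟨r, rfl, hz⟩, s, h, rfl⟩
    exact ⟨r, rfl, by rw [add_zero] at h; rw [← h, hz]; abel⟩
  · rintro ⟨r, rfl, rfl⟩
    exact ⟨r + v, ⟨r, rfl, rfl⟩, r + v, by simp, by abel⟩

/-- As `u` and `v` have disjoint supports, what a round adds is never subtracted by a later round.
So all subtractions can be made before all additions. -/
theorem IsShift.star {P : RegularExpression (CounterOp ι)} {u v : ι → ℕ} (hP : IsShift P u v)
    (huv : ∀ i, u i = 0 ∨ v i = 0) (x y : ι → ℕ) :
    Rel (star P) x y ↔ ∃ (t : ℕ) (r : ι → ℕ), x = r + t • u ∧ y = r + t • v := by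
  rw [rel_star]
  constructor
  · intro h
    induction h with
    | refl => exact ⟨0, x, by simp⟩
    | tail _ h ih =>
      obtain ⟨t, r, rfl, rfl⟩ := ih
      obtain ⟨s, h1, rfl⟩ := (hP _ _).1 h
      -- The truncated subtraction is exact: where `u i ≠ 0`, `v i = 0` and hence `r i = s i + u i`.
      refine ⟨t + 1, fun i => r i - u i, ?_, ?_⟩
      all_goals
        funext i
        have h2 := congrFun h1 i
        simp only [Pi.add_apply, Pi.smul_apply, smul_eq_mul, add_mul, one_mul] at h2 ⊢
        rcases huv i with h | h <;> simp only [h, mul_zero] at h2 ⊢ <;> omega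
  · rintro ⟨t, r, rfl, rfl⟩
    induction t generalizing r with
    | zero => simp only [zero_smul]; exact .refl
    | succ t ih =>
      have h := ih (r + u)
      have h1 : r + u + t • u = r + (t + 1) • u := by rw [add_smul, one_smul]; abel
      rw [h1] at h
      refine h.tail ((hP _ _).2 ⟨r + t • v, by abel, by rw [add_smul, one_smul]; abel⟩)

theorem exists_isShift_dec_pow (i : ι) (n : ℕ) :
    ∃ P : RegularExpression (CounterOp ι), IsShift P (Pi.single i n) 0 := by
  induction n with
  | zero => exact ⟨1, by simpa using isShift_one⟩
  | succ n ih =>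
    obtain ⟨P, hP⟩ := ih
    exact ⟨_, by simpa [Pi.single_add] using hP.mul_left (isShift_dec i)⟩

theorem exists_isShift_inc_pow (i : ι) (n : ℕ) :
    ∃ P : RegularExpression (CounterOp ι), IsShift P 0 (Pi.single i n) := by
  induction n with
  | zero => exact ⟨1, by simpa using isShift_one⟩
  | succ n ih =>
    obtain ⟨P, hP⟩ := ih
    exact ⟨_, by simpa [Pi.single_add] using hP.mul_right (isShift_inc i)⟩

end CounterPrograms

end RegularExpression

/-! ### Languages of regular expressions are regular, by left quotients. -/

namespace Language

open Computability

variable {α : Type}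

/-- Quotients by words are iterated quotients by letters, so all of them stay in `T`; the
Myhill–Nerode criterion applies. -/
theorem leftQuotient_finite_of_closed {T : Set (Language α)} (hT : T.Finite)
    (h : ∀ M ∈ T, ∀ a, M.leftQuotient [a] ∈ T) {L : Language α} (hL : L ∈ T) : L.IsRegular := by
  refine .of_finite_range_leftQuotient (hT.subset ?_)
  rintro _ ⟨x, rfl⟩
  induction x generalizing L with
  | nil => exact hL
  | cons a x ih =>
    rw [show a :: x = [a] ++ x from rfl, leftQuotient_append]
    exact ih (h L hL a)

theorem mem_sSup_iff {U : Set (Language α)} {y : List α} : y ∈ sSup U ↔ ∃ M ∈ U, y ∈ M :=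
  Iff.rfl

/-- A language is regular if it is in a finite family of languages all of whose derivatives by
letters are unions of members of the family. -/
theorem isRegular_of_unions {T : Set (Language α)} (hT : T.Finite)
    (h : ∀ M ∈ T, ∀ a, ∃ U ⊆ T, M.leftQuotient [a] = sSup U) {L : Language α} (hL : L ∈ T) :
    L.IsRegular := by
  -- The unions of subfamilies of `T` form a finite family, which is closed under quotients because
  -- these commute with unions.
  refine leftQuotient_finite_of_closed (hT.finite_subsets.image sSup) ?_
    ⟨{L}, by simpa using hL, by simp⟩
  rintro _ ⟨V, hV, rfl⟩ a
  choose! U hU using fun M (hM : M ∈ T) => h M hM a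
  refine ⟨⋃ M ∈ V, U M, Set.iUnion₂_subset fun M hM => (hU M (hV hM)).1, ?_⟩
  ext y
  rw [mem_leftQuotient, mem_sSup_iff, mem_sSup_iff]
  simp only [Set.mem_iUnion, exists_prop]
  constructor
  · rintro ⟨K, ⟨M, hM, hK⟩, hy⟩
    have : y ∈ M.leftQuotient [a] := (hU M (hV hM)).2 ▸ mem_sSup_iff.2 ⟨K, hK, hy⟩
    exact ⟨M, hM, this⟩
  · rintro ⟨M, hM, hy⟩
    have : y ∈ sSup (U M) := (hU M (hV hM)).2 ▸ hy
    obtain ⟨K, hK, hy⟩ := mem_sSup_iff.1 this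
    exact ⟨K, ⟨M, hM, hK⟩, hy⟩

theorem leftQuotient_mul_singleton_of_notMem {L : Language α} (N : Language α) (a : α)
    (hL : [] ∉ L) : (L * N).leftQuotient [a] = L.leftQuotient [a] * N := by
  ext y
  simp only [mem_leftQuotient, mem_mul]
  constructor
  · rintro ⟨u, hu, v, hv, h⟩
    cases u with
    | nil => exact absurd hu hL
    | cons b u =>
      simp only [List.cons_append, List.nil_append, List.cons.injEq] at h
      obtain ⟨rfl, rfl⟩ := h
      exact ⟨u, hu, v, hv, rfl⟩
  · rintro ⟨u, hu, v, hv, rfl⟩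
    exact ⟨a :: u, hu, v, hv, rfl⟩

theorem leftQuotient_mul_singleton_of_mem {L : Language α} (N : Language α) (a : α)
    (hL : [] ∈ L) :
    (L * N).leftQuotient [a] = L.leftQuotient [a] * N + N.leftQuotient [a] := by
  ext y
  simp only [mem_leftQuotient, mem_add, mem_mul]
  constructor
  · rintro ⟨u, hu, v, hv, h⟩
    cases u with
    | nil => exact .inr (by rw [← h]; exact hv)
    | cons b u =>
      simp only [List.cons_append, List.nil_append, List.cons.injEq] at h
      obtain ⟨rfl, rfl⟩ := h
      exact .inl ⟨u, hu, v, hv, rfl⟩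
  · rintro (⟨u, hu, v, hv, rfl⟩ | h2)
    · exact ⟨a :: u, hu, v, hv, rfl⟩
    · exact ⟨[], hL, _, h2, rfl⟩

theorem leftQuotient_kstar_singleton (L : Language α) (a : α) :
    (L∗).leftQuotient [a] = L.leftQuotient [a] * L∗ := by
  ext y
  simp only [mem_leftQuotient, mem_mul]
  constructor
  · intro h
    obtain ⟨S, hS, hne⟩ := mem_kstar_iff_exists_nonempty.1 h
    cases S with
    | nil => simp at hS
    | cons u S =>
      cases u with
      | nil => exact absurd rfl (hne [] (by simp)).2
      | cons b u =>
        simp only [List.flatten_cons, List.cons_append, List.nil_append, List.cons.injEq] at hS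
        obtain ⟨rfl, rfl⟩ := hS
        exact ⟨u, (hne _ (by simp)).1, _, join_mem_kstar fun v hv => (hne v (by simp [hv])).1, rfl⟩
  · rintro ⟨u, hu, v, ⟨S, rfl, hS⟩, rfl⟩
    refine ⟨(a :: u) :: S, rfl, fun v hv => ?_⟩
    rcases List.mem_cons.1 hv with rfl | hv
    exacts [hu, hS v hv]

/-- By the product rule for quotients, the finite family consists of the products of a quotient of
`L` with `N`, and of the quotients of `N`. -/
theorem IsRegular.mul {L N : Language α} (hL : L.IsRegular) (hN : N.IsRegular) :
    (L * N).IsRegular := by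
  have h1 := hL.finite_range_leftQuotient
  have h2 := hN.finite_range_leftQuotient
  refine isRegular_of_unions (T := (· * N) '' Set.range L.leftQuotient ∪ Set.range N.leftQuotient)
    ((h1.image _).union h2) ?_ (.inl ⟨L, ⟨[], rfl⟩, rfl⟩)
  rintro _ (⟨_, ⟨x, rfl⟩, rfl⟩ | ⟨x, rfl⟩) a
  · by_cases h : [] ∈ L.leftQuotient x
    · refine ⟨{L.leftQuotient (x ++ [a]) * N, N.leftQuotient [a]}, ?_, ?_⟩
      · rintro _ (rfl | rfl)
        exacts [.inl ⟨_, ⟨_, rfl⟩, rfl⟩, .inr ⟨_, rfl⟩]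
      · rw [sSup_pair, leftQuotient_append]
        exact leftQuotient_mul_singleton_of_mem N a h
    · refine ⟨{L.leftQuotient (x ++ [a]) * N}, ?_, ?_⟩
      · rintro _ rfl
        exact .inl ⟨_, ⟨_, rfl⟩, rfl⟩
      · rw [sSup_singleton, leftQuotient_append]
        exact leftQuotient_mul_singleton_of_notMem _ a h
  · exact ⟨{N.leftQuotient (x ++ [a])}, by simp, by rw [sSup_singleton, leftQuotient_append]⟩

/-- The finite family consists of `L∗` and the products of a quotient of `L` with `L∗`. -/
theorem IsRegular.kstar {L : Language α} (hL : L.IsRegular) : (L∗).IsRegular := by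
  have h1 := hL.finite_range_leftQuotient
  refine isRegular_of_unions (T := insert L∗ ((· * L∗) '' Set.range L.leftQuotient))
    ((h1.image _).insert _) ?_ (.inl rfl)
  rintro _ (rfl | ⟨_, ⟨x, rfl⟩, rfl⟩) a
  · exact ⟨{L.leftQuotient [a] * L∗}, by simp, by
      rw [sSup_singleton, leftQuotient_kstar_singleton]⟩
  · by_cases h : [] ∈ L.leftQuotient x
    · refine ⟨{L.leftQuotient (x ++ [a]) * L∗, L.leftQuotient [a] * L∗}, ?_, ?_⟩
      · rintro _ (rfl | rfl)
        exacts [.inr ⟨_, ⟨_, rfl⟩, rfl⟩, .inr ⟨_, ⟨_, rfl⟩, rfl⟩]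
      · rw [sSup_pair, leftQuotient_append, ← leftQuotient_kstar_singleton]
        exact leftQuotient_mul_singleton_of_mem _ a h
    · refine ⟨{L.leftQuotient (x ++ [a]) * L∗}, ?_, ?_⟩
      · rintro _ rfl
        exact .inr ⟨_, ⟨_, rfl⟩, rfl⟩
      · rw [sSup_singleton, leftQuotient_append]
        exact leftQuotient_mul_singleton_of_notMem _ a h

end Language

theorem RegularExpression.isRegular_matches' {α : Type} (P : RegularExpression α) :
    P.matches'.IsRegular := by
  have bot : (0 : Language α).IsRegular :=
    Language.leftQuotient_finite_of_closed (Set.finite_singleton 0) (by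
      rintro _ rfl a; rfl) rfl
  have one : ∀ M ∈ ({1, 0} : Set (Language α)), ∀ a, M.leftQuotient [a] = 0 := by
    rintro _ (rfl | rfl) a
    · ext y; simp [Language.mem_one]
    · rfl
  induction P with
  | zero => exact bot
  | epsilon =>
    exact Language.leftQuotient_finite_of_closed (T := {1, 0}) (by simp)
      (fun M hM a => by simp [one M hM a]) (.inl rfl)
  | char a =>
    refine Language.leftQuotient_finite_of_closed (T := {{[a]}, 1, 0}) (by simp) ?_ (.inl rfl)
    rintro M (rfl | hM) b
    · by_cases h : b = a
      · subst h
        right; left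
        ext y
        rw [Language.mem_leftQuotient, Language.mem_one]
        change [b] ++ y = [b] ↔ _
        simp
      · right; right
        ext y
        rw [Language.mem_leftQuotient]
        change [b] ++ y = [a] ↔ False
        simp [h]
    · right
      simp [one M hM b]
  | plus P Q hP hQ => exact hP.add hQ
  | comp P Q hP hQ => exact hP.mul hQ
  | star P hP => exact hP.kstar

/-! ### Register programs that test graphs of primitive recursive functions. -/

namespace RegularExpression

open Function

section Registers

variable {ι : Type} [DecidableEq ι]

/-- This is the nondeterministic guess of a value for an empty register. -/
theorem rel_star_inc {i : ι} {x : ι → ℕ} (hx : x i = 0) (y : ι → ℕ) :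
    Rel (star (char (CounterOp.inc i))) x y ↔ ∃ v, y = update x i v := by
  rw [(isShift_inc i).star (fun _ => .inl rfl)]
  constructor
  · rintro ⟨t, r, rfl, rfl⟩
    refine ⟨t, ?_⟩
    simp only [smul_zero, add_zero] at hx ⊢
    funext j
    by_cases h : j = i
    · subst h; simp [hx]
    · simp [h]
  · rintro ⟨v, rfl⟩
    refine ⟨v, x, by simp, ?_⟩
    funext j
    by_cases h : j = i
    · subst h; simp [hx]
    · simp [h]

/-- The zero test discards the executions that stop decrementing too early. -/
theorem rel_clear (i : ι) (x y : ι → ℕ) :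
    Rel (star (char (CounterOp.dec i)) * char (CounterOp.zero i)) x y ↔ y = update x i 0 := by
  simp only [rel_mul, rel_char, (isShift_dec i).star (fun _ => .inr rfl), CounterOp.Rel]
  constructor
  · rintro ⟨z, ⟨t, r, rfl, rfl⟩, h, rfl⟩
    simp only [smul_zero, add_zero] at h ⊢
    funext j
    by_cases hj : j = i
    · subst hj; simp [h]
    · simp [hj]
  · rintro rfl
    refine ⟨_, ⟨x i, update x i 0, ?_, by simp⟩, by simp, rfl⟩
    funext j
    by_cases hj : j = i
    · subst hj; simp
    · simp [hj]

theorem rel_star_of_orbit {P : RegularExpression (CounterOp ι)} (F : ℕ → ι → ℕ)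
    (h : ∀ m y, Rel P (F m) y ↔ y = F (m + 1)) (y : ι → ℕ) :
    Rel (star P) (F 0) y ↔ ∃ m, y = F m := by
  rw [rel_star]
  constructor
  · intro h1
    induction h1 with
    | refl => exact ⟨0, rfl⟩
    | tail _ h1 ih =>
      obtain ⟨m, rfl⟩ := ih
      exact ⟨m + 1, (h _ _).1 h1⟩
  · rintro ⟨m, rfl⟩
    induction m with
    | zero => exact .refl
    | succ m ih => exact ih.tail ((h _ _).2 rfl)

end Registers

/-- All registers with numbers at least `k` are zero. -/
def Clean (k : ℕ) (x : ℕ → ℕ) : Prop := ∀ i, k ≤ i → x i = 0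

theorem Clean.mono {k l : ℕ} {x : ℕ → ℕ} (hx : Clean k x) (h : k ≤ l) : Clean l x :=
  fun i hi => hx i (h.trans hi)

theorem Clean.update {k i : ℕ} {x : ℕ → ℕ} (hx : Clean k x) (hi : i < k) (v : ℕ) :
    Clean k (update x i v) := fun j hj => by
  rw [update_of_ne (by omega)]; exact hx j hj

theorem Clean.update_self {k : ℕ} {x : ℕ → ℕ} (hx : Clean k x) (v : ℕ) :
    Clean (k + 1) (Function.update x k v) := (hx.mono k.le_succ).update k.lt_succ_self v

theorem Clean.update_zero {k : ℕ} {x : ℕ → ℕ} (hx : Clean (k + 1) x) :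
    Clean k (Function.update x k 0) := fun j hj => by
  rcases hj.eq_or_lt with rfl | h
  · simp
  · rw [update_of_ne (by omega)]; exact hx j h

/-- The property `S` of the first `k` registers is tested by some counter program that does not
change the registers, provided that the other registers are zero. -/
def Testable (k : ℕ) (S : (ℕ → ℕ) → Prop) : Prop :=
  ∃ P : RegularExpression (CounterOp ℕ), ∀ x, Clean k x → ∀ y, P.Rel x y ↔ y = x ∧ S x

theorem Testable.congr {k : ℕ} {S S' : (ℕ → ℕ) → Prop} (h : Testable k S)
    (hS : ∀ x, Clean k x → (S x ↔ S' x)) : Testable k S' := by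
  obtain ⟨P, hP⟩ := h
  exact ⟨P, fun x hx y => by rw [hP x hx, hS x hx]⟩

theorem Testable.true (k : ℕ) : Testable k fun _ => True :=
  ⟨1, fun x _ y => by rw [rel_one]; simp [eq_comm]⟩

theorem Testable.false (k : ℕ) : Testable k fun _ => False :=
  ⟨0, fun x _ y => by simp [rel_zero]⟩

theorem Testable.and {k : ℕ} {S S' : (ℕ → ℕ) → Prop} (h : Testable k S) (h' : Testable k S') :
    Testable k fun x => S x ∧ S' x := by
  obtain ⟨P, hP⟩ := h
  obtain ⟨Q, hQ⟩ := h'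
  refine ⟨P * Q, fun x hx y => ?_⟩
  rw [rel_mul]
  constructor
  · rintro ⟨z, h1, h2⟩
    obtain ⟨rfl, h1⟩ := (hP x hx z).1 h1
    obtain ⟨rfl, h2⟩ := (hQ _ hx y).1 h2
    exact ⟨rfl, h1, h2⟩
  · rintro ⟨rfl, h1, h2⟩
    exact ⟨y, (hP y hx y).2 ⟨rfl, h1⟩, (hQ y hx y).2 ⟨rfl, h2⟩⟩

theorem Testable.forall_fin {k m : ℕ} {S : Fin m → (ℕ → ℕ) → Prop} (h : ∀ i, Testable k (S i)) :
    Testable k fun x => ∀ i, S i x := by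
  induction m with
  | zero => exact (Testable.true k).congr fun x _ => by simp
  | succ m ih =>
    exact ((h 0).and (ih fun i => h i.succ)).congr fun x _ =>
      (Fin.forall_fin_succ (P := fun i => S i x)).symm

/-- Register `k` is scratch space: a witness is guessed there, tested, and erased. -/
theorem Testable.exists_update {k : ℕ} {S : (ℕ → ℕ) → Prop} (h : Testable (k + 1) S) :
    Testable k fun x => ∃ v, S (update x k v) := by
  obtain ⟨P, hP⟩ := h
  refine ⟨star (char (.inc k)) * (P * (star (char (.dec k)) * char (.zero k))),
    fun x hx y => ?_⟩
  rw [rel_mul]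
  simp only [rel_star_inc (hx k le_rfl), rel_mul P, rel_clear]
  constructor
  · rintro ⟨_, ⟨v, rfl⟩, z, h1, rfl⟩
    obtain ⟨rfl, h2⟩ := (hP _ (hx.update_self v) z).1 h1
    exact ⟨by rw [update_idem, update_eq_self_iff, hx k le_rfl], v, h2⟩
  · rintro ⟨rfl, v, h1⟩
    exact ⟨_, ⟨v, rfl⟩, _, (hP _ (hx.update_self v) _).2 ⟨rfl, h1⟩,
      by rw [update_idem, eq_comm, update_eq_self_iff, hx k le_rfl]⟩

theorem Testable.exists_block {k m : ℕ} {S : (ℕ → ℕ) → Prop} (h : Testable (k + m) S) :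
    Testable k fun x => ∃ y, (∀ i < k, y i = x i) ∧ Clean (k + m) y ∧ S y := by
  induction m generalizing S with
  | zero =>
    refine h.congr fun x hx => ⟨fun h => ⟨x, fun _ _ => rfl, hx, h⟩, ?_⟩
    rintro ⟨y, h1, h2, h3⟩
    rwa [show x = y from funext fun i => if h : i < k then (h1 i h).symm else by
      rw [hx i (not_lt.1 h), h2 i (not_lt.1 h)]]
  | succ m ih =>
    refine (ih (Testable.exists_update h)).congr fun x hx => ⟨?_, ?_⟩
    · rintro ⟨y, h1, h2, v, h3⟩
      exact ⟨_, fun i hi => by rw [update_of_ne (by omega), h1 i hi], h2.update_self v, h3⟩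
    · rintro ⟨y, h1, h2, h3⟩
      refine ⟨update y (k + m) 0, fun i hi => by rw [update_of_ne (by omega), h1 i hi],
        Clean.update_zero h2, y (k + m), by simpa using h3⟩

theorem Testable.zero {k i : ℕ} : Testable k fun x => x i = 0 :=
  ⟨char (.zero i), fun x _ y => by rw [rel_char]; exact and_comm⟩

/-- Registers `i` and `j` are decremented together while the scratch register `k` counts the rounds.
If both are then zero they were equal, and a second loop restores them. -/
theorem Testable.eq {k i j : ℕ} (hi : i < k) (hj : j < k) : Testable k fun x => x i = x j := by
  by_cases hij : i = j
  · subst hij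
    exact (Testable.true k).congr fun x _ => by simp
  have h1 : IsShift (char (.dec i) * char (.dec j) * char (.inc k))
      (Pi.single i 1 + Pi.single j 1) (Pi.single k 1) := by
    simpa using ((isShift_dec i).mul_left (isShift_dec j)).mul_right (isShift_inc k)
  have h2 : IsShift (char (.dec k) * char (.inc i) * char (.inc j)) (Pi.single k 1)
      (Pi.single i 1 + Pi.single j 1) := by
    simpa using ((isShift_dec k).mul_right (isShift_inc i)).mul_right (isShift_inc j)
  have hd : ∀ l, (Pi.single i 1 + Pi.single j 1 : ℕ → ℕ) l = 0 ∨
      (Pi.single k 1 : ℕ → ℕ) l = 0 := by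
    intro l
    by_cases h : l = k
    · left
      subst h
      simp [Pi.single_eq_of_ne (show l ≠ i by omega), Pi.single_eq_of_ne (show l ≠ j by omega)]
    · right
      simp [h]
  refine ⟨star (char (.dec i) * char (.dec j) * char (.inc k)) * char (.zero i) * char (.zero j) *
    star (char (.dec k) * char (.inc i) * char (.inc j)) * char (.zero k), fun x hx y => ?_⟩
  have hk := hx k le_rfl
  have s1 : (Pi.single i 1 : ℕ → ℕ) j = 0 := Pi.single_eq_of_ne (by omega) _
  have s2 : (Pi.single j 1 : ℕ → ℕ) i = 0 := Pi.single_eq_of_ne (by omega) _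
  have s3 : (Pi.single k 1 : ℕ → ℕ) i = 0 := Pi.single_eq_of_ne (by omega) _
  have s4 : (Pi.single k 1 : ℕ → ℕ) j = 0 := Pi.single_eq_of_ne (by omega) _
  have s5 : (Pi.single i 1 : ℕ → ℕ) k = 0 := Pi.single_eq_of_ne (by omega) _
  have s6 : (Pi.single j 1 : ℕ → ℕ) k = 0 := Pi.single_eq_of_ne (by omega) _
  simp only [rel_mul _ (char (.zero k)), rel_mul _ (star (char (.dec k) * _ * _)),
    rel_mul _ (char (.zero i)), rel_mul _ (char (.zero j)), rel_char, h1.star hd,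
    h2.star (fun l => (hd l).symm), CounterOp.Rel]
  constructor
  · rintro ⟨_, ⟨_, ⟨_, ⟨_, ⟨t, r, rfl, rfl⟩, hi0, rfl⟩, hj0, rfl⟩, t', r', hz, rfl⟩, hk0, rfl⟩
    have e := congrFun hz
    simp only [Pi.add_apply, Pi.smul_apply, smul_eq_mul, Pi.single_eq_same, s1, s2, s3, s4, s5,
      s6] at hi0 hj0 hk0 hk e ⊢
    have ek := e k
    simp only [Pi.single_eq_same] at ek
    obtain rfl : t' = t := by omega
    refine ⟨?_, by omega⟩
    rw [add_right_cancel hz]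
  · rintro ⟨rfl, h⟩
    have key : y = update (update y i 0) j 0 + y i • (Pi.single i 1 + Pi.single j 1) := by
      funext l
      by_cases hl : l = i
      · subst hl
        simp [hij]
      · by_cases hl' : l = j
        · subst hl'
          simp [hl, h]
        · simp [hl, hl']
    refine ⟨y, ⟨_, ⟨_, ⟨_, ⟨y i, _, key, rfl⟩, ?_, rfl⟩, ?_, rfl⟩, y i, _, rfl, key⟩, hk, rfl⟩
    · simp [hij, s3]
    · simp [s4]

/-- If the graph of `G` is testable, then there is a program for the assignment `x a := G x`. -/
theorem Testable.assign {k a : ℕ} {G : (ℕ → ℕ) → ℕ} (ha : a < k)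
    (h : Testable (k + 1) fun x => x k = G x) (hG : ∀ x v, G (update x k v) = G x) :
    ∃ P : RegularExpression (CounterOp ℕ),
      ∀ x, Clean k x → ∀ y, P.Rel x y ↔ y = update x a (G x) := by
  obtain ⟨P, hP⟩ := h
  obtain ⟨E, hE⟩ := Testable.eq (k := k + 1) (i := a) (j := k) (by omega) (by omega)
  -- The value is guessed in `k` and verified before `a` is erased, since `G` may depend on `a`. It
  -- is then copied by guessing `a` anew and testing equality with `k`.
  refine ⟨star (char (.inc k)) * (P * ((star (char (.dec a)) * char (.zero a)) *
    (star (char (.inc a)) * (E * (star (char (.dec k)) * char (.zero k)))))), fun x hx y => ?_⟩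
  have hk := hx k le_rfl
  have hak : k ≠ a := by omega
  rw [rel_mul]
  simp only [rel_star_inc hk, rel_mul P, rel_mul (_ * _), rel_clear]
  constructor
  · rintro ⟨_, ⟨v, rfl⟩, z, h1, _, rfl, h2⟩
    obtain ⟨rfl, e1⟩ := (hP _ (hx.update_self v) z).1 h1
    rw [rel_mul] at h2
    obtain ⟨z, h2, h3⟩ := h2
    obtain ⟨w, rfl⟩ := (rel_star_inc (by simp) _).1 h2
    rw [rel_mul] at h3
    obtain ⟨z, h3, h4⟩ := h3
    obtain ⟨rfl, e3⟩ := (hE _ (((hx.update_self v).update (by omega) _).update (by omega) _) z).1 h3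
    rw [(rel_clear _ _ _).1 h4]
    simp only [hG, update_self, ne_eq, hak, not_false_eq_true, update_of_ne] at e1 e3
    subst e1 e3
    funext j
    by_cases hj : j = k
    · subst hj; simp [hak, hk]
    · by_cases hj' : j = a
      · subst hj'; simp [hj]
      · simp [hj, hj']
  · rintro rfl
    refine ⟨_, ⟨G x, rfl⟩, _, (hP _ (hx.update_self _) _).2 ⟨rfl, by simp [hG]⟩, _, rfl, ?_⟩
    rw [rel_mul]
    refine ⟨_, (rel_star_inc (by simp) _).2 ⟨G x, rfl⟩, ?_⟩
    rw [rel_mul]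
    refine ⟨_, (hE _ (((hx.update_self _).update (by omega) _).update (by omega) _) _).2
      ⟨rfl, by simp [hak]⟩, ?_⟩
    rw [rel_clear]
    funext j
    by_cases hj : j = k
    · subst hj; simp [hak, hk]
    · by_cases hj' : j = a
      · subst hj'; simp [hj]
      · simp [hj, hj']

/-- The graph of `f` is testable, whichever registers hold the arguments and the value. -/
def GraphTestable {n : ℕ} (f : List.Vector ℕ n → ℕ) : Prop :=
  ∀ (k : ℕ) (r : Fin n → ℕ) (o : ℕ), (∀ i, r i < k) → o < k →
    Testable k fun x => x o = f (List.Vector.ofFn fun i => x (r i))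

/-- Register `o` is decremented, compared with the argument and incremented again; if `o` itself
holds the argument, the test must fail. -/
theorem graphTestable_succ : GraphTestable fun v : List.Vector ℕ 1 => v.head.succ := by
  intro k r o hr ho
  simp only [List.Vector.head_ofFn]
  by_cases h : o = r 0
  · exact (Testable.false k).congr fun x _ => by simp [h]
  obtain ⟨E, hE⟩ := Testable.eq ho (hr 0)
  refine ⟨char (.dec o) * (E * char (.inc o)), fun x hx y => ?_⟩
  simp only [rel_mul, rel_char, CounterOp.Rel]
  constructor
  · rintro ⟨z, rfl, _, h1, rfl⟩
    have hz : Clean k z := fun i hi => by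
      have := hx i hi
      simp only [Pi.add_apply] at this
      omega
    obtain ⟨rfl, h1⟩ := (hE z hz _).1 h1
    exact ⟨rfl, by simp [h1, Ne.symm h]⟩
  · rintro ⟨rfl, h1⟩
    refine ⟨update y o (y (r 0)), ?_, _, (hE _ (hx.update ho _) _).2 ⟨rfl, by
      simp [Ne.symm h]⟩, ?_⟩
    all_goals
      funext j
      by_cases hj : j = o
      · subst hj; simp [h1]
      · simp [hj]

/-- The intermediate values `g i` are guessed in a block of `n` scratch registers starting at `k`.
-/
theorem GraphTestable.comp {m n : ℕ} {f : List.Vector ℕ n → ℕ} {g : Fin n → List.Vector ℕ m → ℕ}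
    (hf : GraphTestable f) (hg : ∀ i, GraphTestable (g i)) :
    GraphTestable fun a => f (List.Vector.ofFn fun i => g i a) := by
  intro k r o hr ho
  have h1 := Testable.forall_fin fun i : Fin n =>
    hg i (k + n) r (k + i) (fun j => (hr j).trans_le (by omega)) (by omega)
  have h2 := hf (k + n) (fun i => k + i) o (fun i => by omega) (by omega)
  refine (h1.and h2).exists_block.congr fun x hx => ⟨?_, ?_⟩
  · rintro ⟨y, h3, -, h4, h5⟩
    rw [← h3 o ho, h5]
    simp only [h4, h3 _ (hr _)]
  · intro h3
    refine ⟨fun j => if j < k then x j else if h : j - k < n then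
      g ⟨j - k, h⟩ (List.Vector.ofFn fun i => x (r i)) else 0, ?_, ?_, ?_, ?_⟩
    · intro i hi
      simp [hi]
    · intro i hi
      simp [show ¬ i < k by omega, show ¬ i - k < n by omega]
    · intro i
      simp [hr]
    · simp [ho, h3]

theorem GraphTestable.prec {n : ℕ} {f : List.Vector ℕ n → ℕ} {g : List.Vector ℕ (n + 2) → ℕ}
    (hf : GraphTestable f) (hg : GraphTestable g) :
    GraphTestable fun v : List.Vector ℕ (n + 1) =>
      v.head.rec (f v.tail) fun y IH => g (y ::ᵥ IH ::ᵥ v.tail) := by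
  intro k r o hr ho
  have hr' : ∀ i, r i ≠ k ∧ r i ≠ k + 1 ∧ r i ≠ k + 2 := fun i => by
    have := hr i; omega
  obtain ⟨A, hA⟩ := (hf (k + 3) (fun i => r i.succ) (k + 2) (fun i => by
    have := hr i.succ; omega) (by omega)).assign (k := k + 2) (a := k + 1) (by omega)
    (fun x v => by simp [hr'])
  obtain ⟨B, hB⟩ := (hg (k + 3) (Fin.cons k (Fin.cons (k + 1) fun i => r i.succ)) (k + 2)
    (fun i => by
      refine Fin.cases ?_ (fun i => Fin.cases ?_ (fun i => ?_) i) i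
      · simp
      · simp
      · have := hr i.succ
        simp only [Fin.cons_succ]
        omega) (by omega)).assign (k := k + 2) (a := k + 1) (by omega)
    (fun x v => by
      congr 2
      funext i
      refine Fin.cases ?_ (fun i => Fin.cases ?_ (fun i => ?_) i) i
      · simp
      · simp
      · simp [hr'])
  obtain ⟨C, hC⟩ := Testable.eq (k := k + 2) (i := k) (j := r 0) (by omega)
    (by have := hr 0; omega)
  obtain ⟨D, hD⟩ := Testable.eq (k := k + 2) (i := o) (j := k + 1) (by omega) (by omega)
  -- Register `k` counts the rounds of the recursion, `k + 1` holds the current value, and `k + 2`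
  -- is scratch space for the assignments `A` and `B`. The number of rounds is guessed; `C` checks
  -- it against the recursion argument and `D` compares the result with `o`.
  refine ⟨A * (star (B * char (.inc k)) * (C * (D * ((star (char (.dec k)) * char (.zero k)) *
    (star (char (.dec (k + 1))) * char (.zero (k + 1))))))), fun x hx y => ?_⟩
  simp only [List.Vector.head_ofFn, List.Vector.tail_ofFn]
  set V := List.Vector.ofFn fun i : Fin n => x (r i.succ) with hV
  set c : ℕ → ℕ := fun m => Nat.rec (f V) (fun y IH => g (y ::ᵥ IH ::ᵥ V)) m with hc
  set F : ℕ → ℕ → ℕ := fun m => update (update x k m) (k + 1) (c m) with hF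
  have hFc : ∀ m, Clean (k + 2) (F m) := fun m => (hx.update_self m).update_self _
  have hk : x k = 0 := hx k le_rfl
  have hk1 : x (k + 1) = 0 := hx (k + 1) (by omega)
  have hF0 : update x (k + 1) (f V) = F 0 := by
    simp only [hF]
    rw [show update x k 0 = x by rw [update_eq_self_iff, hk]]
    rfl
  have hstep : ∀ m z, Rel (B * char (.inc k)) (F m) z ↔ z = F (m + 1) := by
    intro m z
    have e : (List.Vector.ofFn fun i : Fin (n + 2) =>
        F m ((Fin.cons k (Fin.cons (k + 1) fun i => r i.succ) : Fin (n + 2) → ℕ) i)) =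
        m ::ᵥ c m ::ᵥ V := by
      rw [List.Vector.ofFn, List.Vector.ofFn]
      simp [hF, hV, hr']
    simp only [rel_mul, rel_char, CounterOp.Rel, hB _ (hFc m), e, exists_eq_left]
    rw [show update (F m) (k + 1) (g (m ::ᵥ c m ::ᵥ V)) + Pi.single k 1 = F (m + 1) from ?_]
    funext j
    by_cases h1 : j = k
    · subst h1; simp [hF]
    · by_cases h2 : j = k + 1
      · subst h2; simp [hF, hc]
      · simp [hF, h1, h2]
  have hclear : ∀ m, update (update (F m) k 0) (k + 1) 0 = x := by
    intro m
    funext j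
    by_cases h1 : j = k
    · subst h1; simp [hk]
    · by_cases h2 : j = k + 1
      · subst h2; simp [hk1]
      · simp [hF, h1, h2]
  rw [rel_mul]
  simp only [hA _ (hx.mono (show k ≤ k + 2 by omega)), ← hV, hF0, exists_eq_left]
  rw [rel_mul]
  simp only [rel_star_of_orbit F hstep]
  have ho' : o ≠ k ∧ o ≠ k + 1 := by omega
  constructor
  · rintro ⟨_, ⟨m, rfl⟩, h⟩
    rw [rel_mul] at h
    obtain ⟨z, h1, h⟩ := h
    obtain ⟨rfl, e1⟩ := (hC _ (hFc m) z).1 h1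
    rw [rel_mul] at h
    obtain ⟨z, h2, h⟩ := h
    obtain ⟨rfl, e2⟩ := (hD _ (hFc m) z).1 h2
    rw [rel_mul] at h
    obtain ⟨z, h3, h4⟩ := h
    rw [rel_clear] at h3 h4
    subst h3 h4
    simp only [hF, update_self, ne_eq, hr', ho', not_false_eq_true, update_of_ne,
      Nat.left_eq_add, one_ne_zero] at e1 e2
    exact ⟨hclear m, by rw [e2, e1]⟩
  · rintro ⟨rfl, h⟩
    refine ⟨_, ⟨y (r 0), rfl⟩, ?_⟩
    rw [rel_mul]
    refine ⟨_, (hC _ (hFc _) _).2 ⟨rfl, by simp [hF, hr']⟩, ?_⟩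
    rw [rel_mul]
    refine ⟨_, (hD _ (hFc _) _).2 ⟨rfl, by simp [hF, ho', hc, h]⟩, ?_⟩
    rw [rel_mul]
    exact ⟨_, (rel_clear _ _ _).2 rfl, (rel_clear _ _ _).2 (hclear _).symm⟩

theorem graphTestable_of_primrec' {n : ℕ} {f : List.Vector ℕ n → ℕ} (hf : Nat.Primrec' f) :
    GraphTestable f := by
  induction hf with
  | zero => exact fun k r o _ _ => Testable.zero
  | succ => exact graphTestable_succ
  | get i =>
    exact fun k r o hr ho => (Testable.eq ho (hr i)).congr fun x _ => by simp
  | comp g _ _ hf hg => exact hf.comp hg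
  | prec _ _ hf hg => exact hf.prec hg

/-- Some counter program decides the halting problem in the sense that it can be executed from
the encoding of a code `c` iff the computation of `c` on the input `0` halts. -/
theorem exists_program_halting :
    ∃ P : RegularExpression (CounterOp ℕ), ∀ c : Nat.Partrec.Code,
      (∃ y, P.Rel (Pi.single 0 (Encodable.encode c)) y) ↔ (c.eval 0).Dom := by
  -- This function vanishes iff the code in register 0 halts within the step bound in register 1, as
  -- `none` has encoding 0 and `some` a positive one. The bound is guessed below, and register 2,
  -- which stays zero, serves as the value to compare with.
  have hp : Primrec fun v : List.Vector ℕ 2 =>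
      1 - Encodable.encode (Nat.Partrec.Code.evaln (v.get 1)
        (Denumerable.ofNat Nat.Partrec.Code (v.get 0)) 0) := by
    refine Primrec.nat_sub.comp (.const 1) (Primrec.encode.comp
      (Nat.Partrec.Code.primrec_evaln.comp (.pair (.pair ?_ ?_) (.const 0))))
    · exact Primrec.vector_get.comp .id (.const 1)
    · exact (Primrec.ofNat _).comp (Primrec.vector_get.comp .id (.const 0))
  obtain ⟨P, hP⟩ := graphTestable_of_primrec' (Nat.Primrec'.of_prim hp) 3 (fun i => i) 2
    (fun i => by omega) (by omega)
  refine ⟨star (char (.inc 1)) * P, fun c => ?_⟩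
  simp only [rel_mul, rel_star_inc (show (Pi.single 0 (Encodable.encode c) : ℕ → ℕ) 1 = 0 by simp)]
  have hc : ∀ v, Clean 3 (update (Pi.single 0 (Encodable.encode c) : ℕ → ℕ) 1 v) := by
    intro v
    refine Clean.update (fun j hj => ?_) (by omega) v
    exact Pi.single_eq_of_ne (by omega) _
  constructor
  · rintro ⟨y, _, ⟨v, rfl⟩, h⟩
    obtain ⟨-, h⟩ := (hP _ (hc v) y).1 h
    simp only [List.Vector.get_ofFn] at h
    cases he : Nat.Partrec.Code.evaln v c 0 with
    | none => simp [he] at h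
    | some a => exact Part.dom_iff_mem.2 ⟨a, Nat.Partrec.Code.evaln_sound he⟩
  · intro h
    obtain ⟨a, ha⟩ := Part.dom_iff_mem.1 h
    obtain ⟨v, hv⟩ := Nat.Partrec.Code.evaln_complete.1 ha
    refine ⟨_, _, ⟨v, rfl⟩, (hP _ (hc v) _).2 ⟨rfl, ?_⟩⟩
    simp [Option.mem_def.1 hv]

end RegularExpression

/-! ### Simulation of all registers by two counters, using prime exponents. -/

namespace RegularExpression

/-- A loop trades `u` units of the first counter for `v` units of the second until the first is
empty; then the second is poured back. With `u` or `v` equal to 1 this is multiplication or exact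
division. -/
theorem exists_scale (u v : ℕ) : ∃ P : RegularExpression (CounterOp Bool), ∀ N d,
    P.Rel (Pi.single false N) d ↔ ∃ t, N = t * u ∧ d = Pi.single false (t * v) := by
  obtain ⟨D, hD⟩ := exists_isShift_dec_pow false u
  obtain ⟨I, hI⟩ := exists_isShift_inc_pow true v
  have h1 : IsShift (D * I) (Pi.single false u) (Pi.single true v) := by
    simpa using hD.mul_right hI
  have h2 : IsShift (char (.dec true) * char (.inc false)) (Pi.single true 1)
      (Pi.single false 1) := by simpa using (isShift_dec true).mul_right (isShift_inc false)
  refine ⟨star (D * I) * (char (.zero false) * (star (char (.dec true) * char (.inc false)) *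
    char (.zero true))), fun N d => ?_⟩
  rw [rel_mul]
  simp only [rel_mul (char _), rel_mul (star _), rel_char,
    h1.star (by simp), h2.star (by simp), CounterOp.Rel]
  constructor
  · rintro ⟨_, ⟨t, r, hN, rfl⟩, _, ⟨h0, rfl⟩, _, ⟨t', r', h3, rfl⟩, h4, rfl⟩
    have a1 := congrFun hN false
    have a2 := congrFun hN true
    have a3 := congrFun h3 false
    have a4 := congrFun h3 true
    simp at a1 a2 a3 a4 h0 h4
    refine ⟨t, by omega, ?_⟩
    funext b
    cases b
    · simp; omega
    · simp; omega
  · rintro ⟨t, rfl, rfl⟩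
    refine ⟨_, ⟨t, 0, ?_, rfl⟩, _, ⟨by simp, rfl⟩, _, ⟨t * v, 0, ?_, rfl⟩, by simp, ?_⟩
    all_goals
      funext b
      cases b <;> simp

/-- Between subtracting and restoring `r`, scaling by `p / p` changes nothing but requires
divisibility by `p`. -/
theorem exists_residue_test (p r : ℕ) : ∃ P : RegularExpression (CounterOp Bool), ∀ N d,
    P.Rel (Pi.single false N) d ↔ (∃ t, N = t * p + r) ∧ d = Pi.single false N := by
  obtain ⟨D, hD⟩ := exists_isShift_dec_pow false r
  obtain ⟨I, hI⟩ := exists_isShift_inc_pow false r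
  obtain ⟨S, hS⟩ := exists_scale p p
  refine ⟨D * (S * I), fun N d => ?_⟩
  simp only [rel_mul, hD _ _, hI _ _]
  constructor
  · rintro ⟨_, ⟨z, hN, rfl⟩, e, h1, z', rfl, rfl⟩
    have hz : z = Pi.single false (z false) := by
      have a2 := congrFun hN true
      funext b
      cases b
      · simp
      · simpa using a2.symm
    rw [add_zero, hz] at h1
    obtain ⟨t, h2, h3⟩ := (hS _ _).1 h1
    rw [add_zero] at h3
    have a1 := congrFun hN false
    simp only [Pi.single_eq_same, Pi.add_apply] at a1
    rw [h3, a1, h2, ← Pi.single_add]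
    exact ⟨⟨t, rfl⟩, rfl⟩
  · rintro ⟨⟨t, rfl⟩, rfl⟩
    exact ⟨Pi.single false (t * p), ⟨Pi.single false (t * p), by rw [Pi.single_add], by simp⟩,
      Pi.single false (t * p), (hS _ _).2 ⟨t, rfl, rfl⟩, Pi.single false (t * p), by simp,
      by rw [Pi.single_add]⟩

theorem exists_nondivisibility_test (p : ℕ) : ∃ P : RegularExpression (CounterOp Bool), ∀ N d,
    P.Rel (Pi.single false N) d ↔ ¬ p ∣ N ∧ d = Pi.single false N := by
  have key : ∀ n, ∃ P : RegularExpression (CounterOp Bool), ∀ N d,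
      P.Rel (Pi.single false N) d ↔
        (∃ r < n, ∃ t, N = t * p + (r + 1)) ∧ d = Pi.single false N := by
    intro n
    induction n with
    | zero => exact ⟨0, fun N d => by simp [rel_zero]⟩
    | succ n ih =>
      obtain ⟨P, hP⟩ := ih
      obtain ⟨Q, hQ⟩ := exists_residue_test p (n + 1)
      refine ⟨P + Q, fun N d => ?_⟩
      rw [rel_add, hP, hQ, ← or_and_right]
      simp only [Nat.lt_succ_iff_lt_or_eq, or_and_right, exists_or, exists_eq_left]
  -- For `p = 0` nondivisibility means that `N` is positive; otherwise it is a finite disjunction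
  -- over the nonzero residues.
  rcases Nat.eq_zero_or_pos p with rfl | hp
  · obtain ⟨P, hP⟩ := exists_residue_test 1 1
    refine ⟨P, fun N d => ?_⟩
    rw [hP, zero_dvd_iff]
    refine and_congr_left fun _ => ⟨?_, fun h => ⟨N - 1, by omega⟩⟩
    rintro ⟨t, rfl⟩
    omega
  · obtain ⟨P, hP⟩ := key (p - 1)
    refine ⟨P, fun N d => ?_⟩
    rw [hP]
    refine and_congr_left fun _ => ⟨?_, fun h => ?_⟩
    · rintro ⟨r, hr, t, rfl⟩ h
      have := (Nat.dvd_add_right (dvd_mul_left p t)).1 h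
      have := Nat.le_of_dvd (by omega) this
      omega
    · have h1 : N % p ≠ 0 := fun h' => h (Nat.dvd_of_mod_eq_zero h')
      have h2 := Nat.mod_lt N hp
      refine ⟨N % p - 1, by omega, N / p, ?_⟩
      have := Nat.div_add_mod' N p
      omega

/-- The first of two counters holds a number in which the exponent of the `i`-th prime number is
the value `x i` of the `i`-th register; the second one holds zero. -/
def GodelEncodes (x : ℕ → ℕ) (c : Bool → ℕ) : Prop :=
  ∃ N, N ≠ 0 ∧ c = Pi.single false N ∧ ∀ i, N.factorization (Nat.nth Nat.Prime i) = x i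

theorem factorization_nth_prime_mul {N : ℕ} (hN : N ≠ 0) (i j : ℕ) :
    (N * Nat.nth Nat.Prime i).factorization (Nat.nth Nat.Prime j) =
      N.factorization (Nat.nth Nat.Prime j) + (Pi.single i 1 : ℕ → ℕ) j := by
  have hi := Nat.prime_nth_prime i
  rw [Nat.factorization_mul hN hi.ne_zero, Finsupp.add_apply, hi.factorization]
  congr 1
  by_cases h : j = i
  · subst h; simp
  · rw [Pi.single_eq_of_ne h, Finsupp.single_eq_of_ne]
    exact fun h' => h (Nat.nth_injective Nat.infinite_setOfPred_prime h')

/-- On register `i`, incrementing is multiplication by the `i`-th prime, decrementing is division by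
it, and testing for zero is nondivisibility. -/
theorem exists_subst_godel : ∃ f : CounterOp ℕ → RegularExpression (CounterOp Bool),
    (∀ a x c, GodelEncodes x c → ∀ y, a.Rel x y → ∃ d, (f a).Rel c d ∧ GodelEncodes y d) ∧
    (∀ a x c, GodelEncodes x c → ∀ d, (f a).Rel c d → ∃ y, a.Rel x y ∧ GodelEncodes y d) := by
  choose S hS using exists_scale
  choose T hT using exists_nondivisibility_test
  let p := Nat.nth Nat.Prime
  refine ⟨fun
    | .inc i => S 1 (p i)
    | .dec i => S (p i) 1
    | .zero i => T (p i), ?_, ?_⟩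
  · rintro (i | i | i) x _ ⟨N, hN, rfl, hx⟩ y h <;> simp only [CounterOp.Rel] at h
    · subst h
      refine ⟨_, (hS _ _ _ _).2 ⟨N, (mul_one N).symm, rfl⟩, N * p i,
        mul_ne_zero hN (Nat.prime_nth_prime i).ne_zero, rfl, fun j => ?_⟩
      rw [factorization_nth_prime_mul hN, hx, Pi.add_apply]
    · subst h
      have hd : p i ∣ N := by
        rw [← Nat.pow_one (p i), (Nat.prime_nth_prime i).pow_dvd_iff_le_factorization hN, hx]
        simp
      obtain ⟨M, rfl⟩ := hd
      have hM : M ≠ 0 := right_ne_zero_of_mul hN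
      refine ⟨_, (hS _ _ _ _).2 ⟨M, mul_comm _ _, rfl⟩, M * 1, by simpa using hM, rfl,
        fun j => ?_⟩
      have := hx j
      rw [mul_comm, factorization_nth_prime_mul hM, Pi.add_apply] at this
      rw [mul_one]
      exact Nat.add_right_cancel this
    · obtain ⟨h, rfl⟩ := h
      refine ⟨_, (hT _ _ _).2 ⟨fun hd => ?_, rfl⟩, N, hN, rfl, hx⟩
      rw [← Nat.pow_one (p i), (Nat.prime_nth_prime i).pow_dvd_iff_le_factorization hN, hx] at hd
      omega
  · rintro (i | i | i) x _ ⟨N, hN, rfl, hx⟩ d h <;> simp only [CounterOp.Rel]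
    · obtain ⟨t, rfl, rfl⟩ := (hS _ _ _ _).1 h
      rw [mul_one] at hN hx
      refine ⟨_, rfl, t * p i, mul_ne_zero hN (Nat.prime_nth_prime i).ne_zero, rfl, fun j => ?_⟩
      rw [factorization_nth_prime_mul hN, hx, Pi.add_apply]
    · obtain ⟨t, rfl, rfl⟩ := (hS _ _ _ _).1 h
      have ht : t ≠ 0 := left_ne_zero_of_mul hN
      refine ⟨fun j => t.factorization (p j), ?_, t * 1, by simpa using ht, rfl, by simp [p]⟩
      funext j
      rw [← hx, factorization_nth_prime_mul ht, Pi.add_apply]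
    · obtain ⟨hd, rfl⟩ := (hT _ _ _).1 h
      refine ⟨x, ⟨?_, rfl⟩, N, hN, rfl, hx⟩
      rw [← hx]
      exact Nat.factorization_eq_zero_of_not_dvd hd

/-- Halting of two-counter programs: some program with two counters can be executed from the
counter values `(b ^ c, 0)`, where `c` encodes a partial recursive function and `b > 0` is fixed,
iff the function is defined at `0`. -/
theorem exists_two_counter_program_halting :
    ∃ (b : ℕ) (P : RegularExpression (CounterOp Bool)), 0 < b ∧ ∀ c : Nat.Partrec.Code,
      (∃ d, P.Rel (Pi.single false (b ^ Encodable.encode c)) d) ↔ (c.eval 0).Dom := by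
  obtain ⟨P, hP⟩ := exists_program_halting
  obtain ⟨f, forth, back⟩ := exists_subst_godel
  have hp := Nat.prime_nth_prime 0
  refine ⟨Nat.nth Nat.Prime 0, P.subst f, hp.pos, fun c => ?_⟩
  have h0 : GodelEncodes (Pi.single 0 (Encodable.encode c))
      (Pi.single false (Nat.nth Nat.Prime 0 ^ Encodable.encode c)) := by
    refine ⟨_, pow_ne_zero _ hp.ne_zero, rfl, fun i => ?_⟩
    rw [hp.factorization_pow]
    by_cases h : i = 0
    · subst h; simp
    · rw [Pi.single_eq_of_ne h, Finsupp.single_eq_of_ne]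
      exact fun h' => h (Nat.nth_injective Nat.infinite_setOfPred_prime h')
  obtain ⟨h1, h2⟩ := subst_simulation f GodelEncodes forth back P _ _ h0
  rw [← hP]
  constructor
  · rintro ⟨d, hd⟩
    obtain ⟨y, hy, -⟩ := h2 d hd
    exact ⟨y, hy⟩
  · rintro ⟨y, hy⟩
    obtain ⟨d, hd, -⟩ := h1 y hy
    exact ⟨d, hd⟩

end RegularExpression

/-! ### Operations as seen by a single counter. -/

namespace CounterOp

section
variable {ι : Type} [DecidableEq ι]

/-- The effect of an operation on the counter `i`. -/
def Track (i : ι) : CounterOp ι → ℕ → ℕ → Prop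
  | inc j, t, t' => t' = t + (Pi.single j 1 : ι → ℕ) i
  | dec j, t, t' => t = t' + (Pi.single j 1 : ι → ℕ) i
  | zero j, t, t' => (j = i → t = 0) ∧ t' = t

/-- The effect of a sequence of operations on the counter `i`. -/
def TrackWord (i : ι) : List (CounterOp ι) → ℕ → ℕ → Prop
  | [], t, t' => t = t'
  | a :: w, t, t' => ∃ s, a.Track i t s ∧ TrackWord i w s t'

theorem rel_iff_track (a : CounterOp ι) (x y : ι → ℕ) :
    a.Rel x y ↔ ∀ i, a.Track i (x i) (y i) := by
  cases a with
  | inc j => exact funext_iff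
  | dec j => exact funext_iff
  | zero j =>
    simp only [Rel, Track, funext_iff, forall_and, forall_eq']

/-- Each operation acts on the counters independently. Hence the two branches of the automaton can
each watch one counter. -/
theorem exec_iff_trackWord (w : List (CounterOp ι)) (x y : ι → ℕ) :
    Exec w x y ↔ ∀ i, TrackWord i w (x i) (y i) := by
  induction w generalizing x with
  | nil => exact funext_iff
  | cons a w ih =>
    simp only [Exec, TrackWord, rel_iff_track, ih]
    constructor
    · rintro ⟨z, h1, h2⟩ i
      exact ⟨z i, h1 i, h2 i⟩
    · intro h
      choose z h1 h2 using h
      exact ⟨z, h1, h2⟩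

theorem Track.unique {i : ι} {a : CounterOp ι} {t s s' : ℕ} (h : a.Track i t s)
    (h' : a.Track i t s') : s = s' := by
  cases a <;> simp only [Track] at h h' <;> omega

theorem exec_replicate_inc (i : ι) (n : ℕ) (x y : ι → ℕ) :
    Exec (List.replicate n (inc i)) x y ↔ y = x + Pi.single i n := by
  induction n generalizing x with
  | zero => simp [Exec, eq_comm]
  | succ n ih =>
    simp only [List.replicate_succ, Exec, Rel, exists_eq_left, ih]
    rw [add_assoc, ← Pi.single_add, add_comm 1 n]

/-- The transitions of an automaton that has the counter `i` of a machine as its only counter and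
simulates an operation: `z` is the result of the test for zero, and `d` is the change. -/
def Allows (i : ι) : CounterOp ι → Bool → SignType → Prop
  | inc j, _, d => d = if j = i then 1 else 0
  | dec j, z, d => (d = if j = i then -1 else 0) ∧ (j = i → z = false)
  | zero j, z, d => d = 0 ∧ (j = i → z = true)

theorem track_iff_allows (i : ι) (a : CounterOp ι) (t t' : ℕ) :
    a.Track i t t' ↔ ∃ d : SignType, a.Allows i (decide (t = 0)) d ∧ (t' : ℤ) = t + (d : ℤ) := by
  cases a with
  | inc j =>
    simp only [Track, Allows, exists_eq_left]
    by_cases h : j = i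
    · subst h; simp; omega
    · simp [h, Ne.symm h]
  | dec j =>
    simp only [Track, Allows, and_assoc, exists_eq_left]
    by_cases h : j = i
    · subst h; simp; omega
    · simp [h, Ne.symm h]; omega
  | zero j =>
    simp only [Track, Allows, and_assoc, exists_eq_left]
    by_cases h : j = i
    · subst h; simp
    · simp [h]

/-- An allowed transition is never blocked by a negative counter, so a violation is visible from the
zero test alone. -/
theorem Allows.exists_track {i : ι} {a : CounterOp ι} {t : ℕ} {d : SignType}
    (h : a.Allows i (decide (t = 0)) d) : ∃ t', a.Track i t t' := by
  cases a with
  | inc j => exact ⟨_, rfl⟩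
  | dec j =>
    by_cases hj : j = i
    · subst hj
      have := h.2 rfl
      simp only [decide_eq_false_iff_not] at this
      exact ⟨t - 1, by simp only [Track, Pi.single_eq_same]; omega⟩
    · exact ⟨t, by simp [Track, Ne.symm hj]⟩
  | zero j => exact ⟨t, fun hj => by simpa using h.2 hj, rfl⟩

end

/-- The number of an operation on two counters as a letter. -/
def letter : CounterOp Bool → Fin 8
  | inc false => 0
  | inc true => 1
  | dec false => 2
  | dec true => 3
  | zero false => 4
  | zero true => 5

theorem letter_injective : Function.Injective letter := by
  rintro (⟨_ | _⟩ | ⟨_ | _⟩ | ⟨_ | _⟩) (⟨_ | _⟩ | ⟨_ | _⟩ | ⟨_ | _⟩) h <;> first | rfl | cases h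

theorem letter_lt (a : CounterOp Bool) : (letter a : ℕ) < 6 := by
  rcases a with (⟨_ | _⟩ | ⟨_ | _⟩ | ⟨_ | _⟩) <;> decide

theorem exists_letter_eq {l : Fin 8} (h : (l : ℕ) < 6) : ∃ a, letter a = l := by
  obtain ⟨l, hl⟩ := l
  simp only at h
  interval_cases l
  exacts [⟨inc false, rfl⟩, ⟨inc true, rfl⟩, ⟨dec false, rfl⟩, ⟨dec true, rfl⟩, ⟨zero false, rfl⟩,
    ⟨zero true, rfl⟩]

end CounterOp

/-! ### The one-counter automaton of the reduction. -/

namespace OCACode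

open CounterOp

variable {m : ℕ}

/-- The control of the automata below: the moves of a finite automaton with states `0, …, m - 1`,
preceded by the states `m + j` in which the first counter still has to be incremented `j + 1`
times. -/
inductive Edge (M : DFA (CounterOp Bool) (Fin m)) : ℕ → CounterOp Bool → ℕ → Prop
  | move (s : Fin m) (a : CounterOp Bool) : Edge M s a (M.step s a)
  | enter : Edge M m (inc false) M.start
  | load (j : ℕ) : Edge M (m + j + 1) (inc false) (m + j)

/-- Paths in the control. -/
def Path (M : DFA (CounterOp Bool) (Fin m)) : List (CounterOp Bool) → ℕ → ℕ → Prop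
  | [], s, s' => s = s'
  | a :: w, s, s' => ∃ r, Edge M s a r ∧ Path M w r s'

theorem edge_fin (M : DFA (CounterOp Bool) (Fin m)) (s : Fin m) (a : CounterOp Bool) (r : ℕ) :
    Edge M s a r ↔ r = M.step s a := by
  constructor
  · intro h
    generalize hs : (s : ℕ) = s' at h
    cases h with
    | move s' a => rw [Fin.ext hs]
    | enter => omega
    | load j => omega
  · rintro rfl
    exact .move s a

theorem path_fin (M : DFA (CounterOp Bool) (Fin m)) (w : List (CounterOp Bool)) (s : Fin m)
    (r : ℕ) : Path M w s r ↔ r = M.evalFrom s w := by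
  induction w generalizing s with
  | nil => exact eq_comm
  | cons a w ih =>
    simp only [Path, edge_fin, exists_eq_left, ih, DFA.evalFrom_cons]

/-- There are `j` loading edges, and entering `M` from the state `m` costs one further increment. -/
theorem path_load (M : DFA (CounterOp Bool) (Fin m)) (w : List (CounterOp Bool)) (j : ℕ)
    (s : Fin m) : Path M w (m + j) s ↔
      ∃ u, w = List.replicate (j + 1) (inc false) ++ u ∧ s = M.eval u := by
  induction j generalizing w with
  | zero =>
    cases w with
    | nil => simp only [Path]; simp; omega
    | cons a w =>
      have : ∀ r, Edge M (m + 0) a r ↔ a = inc false ∧ r = M.start := by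
        intro r
        constructor
        · intro h
          generalize hs : m + 0 = s' at h
          cases h with
          | move s' a => omega
          | enter => exact ⟨rfl, rfl⟩
          | load j => omega
        · rintro ⟨rfl, rfl⟩
          exact .enter
      simp only [Path, this]
      constructor
      · rintro ⟨_, ⟨rfl, rfl⟩, h⟩
        exact ⟨w, rfl, Fin.ext ((path_fin M w _ _).1 h)⟩
      · rintro ⟨u, h, rfl⟩
        simp only [zero_add, List.replicate_one, List.cons_append, List.nil_append,
          List.cons.injEq] at h
        obtain ⟨rfl, rfl⟩ := h
        exact ⟨_, ⟨rfl, rfl⟩, (path_fin M w _ _).2 rfl⟩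
  | succ j ih =>
    cases w with
    | nil => simp only [Path]; simp [List.replicate_succ]; omega
    | cons a w =>
      have : ∀ r, Edge M (m + (j + 1)) a r ↔ a = inc false ∧ r = m + j := by
        intro r
        constructor
        · intro h
          generalize hs : m + (j + 1) = s' at h
          cases h with
          | move s' a => omega
          | enter => omega
          | load j => exact ⟨rfl, by omega⟩
        · rintro ⟨rfl, rfl⟩
          exact .load j
      simp only [Path, this]
      constructor
      · rintro ⟨_, ⟨rfl, rfl⟩, h⟩
        obtain ⟨u, rfl, hs⟩ := (ih w).1 h
        exact ⟨u, rfl, hs⟩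
      · rintro ⟨u, h, rfl⟩
        rw [List.replicate_succ, List.cons_append, List.cons.injEq] at h
        obtain ⟨rfl, rfl⟩ := h
        exact ⟨_, ⟨rfl, rfl⟩, (ih _).2 ⟨u, rfl, rfl⟩⟩

/-- The transitions of the automaton `gameCode M j` that do not depend on `j`. -/
inductive FixedTrans (M : DFA (CounterOp Bool) (Fin m)) : ℕ × Bool × ℕ × SignType × ℕ → Prop
  -- State 0 is initial, 1 follows the second counter, 2 is an accepting sink, and `3 + s` stands
  -- for the control state `s`.
  | choose : FixedTrans M (0, true, 6, 0, 1)
  | track {a : CounterOp Bool} {z : Bool} {d : SignType} (h : a.Allows true z d) :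
      FixedTrans M (1, z, a.letter, d, 1)
  | error {a : CounterOp Bool} {z : Bool} (h : ∀ d, ¬ a.Allows true z d) :
      FixedTrans M (1, z, a.letter, 0, 2)
  | other (z : Bool) {l : Fin 8} (h : 6 ≤ (l : ℕ)) : FixedTrans M (1, z, l, 0, 2)
  | sink (z : Bool) (l : Fin 8) : FixedTrans M (2, z, l, 0, 2)
  | move {a : CounterOp Bool} {z : Bool} {d : SignType} (s : Fin m) (h : a.Allows false z d) :
      FixedTrans M (3 + s, z, a.letter, d, 3 + M.step s a)
  | enter (z : Bool) : FixedTrans M (3 + m, z, 0, 1, 3 + M.start)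

/-- Finiteness is enough: the list of these transitions depends on `M` only, so it is a constant of
the reduction and need not be computed. -/
theorem finite_fixedTrans (M : DFA (CounterOp Bool) (Fin m)) :
    {t | FixedTrans M t}.Finite := by
  refine Set.Finite.subset (s := Set.Iio (4 + m) ×ˢ Set.univ ×ˢ Set.Iio 8 ×ˢ Set.univ ×ˢ
    Set.Iio (4 + m)) ?_ ?_
  · exact (Set.finite_Iio _).prod (Set.finite_univ.prod ((Set.finite_Iio _).prod
      (Set.finite_univ.prod (Set.finite_Iio _))))
  · intro t ht
    cases ht <;> simp <;> omega

/-- The automaton of the reduction. Its first transition, on the letter `6`, leads to the state `1`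
or to the state `3 + m + j`. In the latter case it checks that a word of operations consists of
`j + 1` increments of the first counter and a word accepted by `M`, and can be executed as far as
the first counter is concerned. In the former case it finds out that a word cannot be executed as
far as the second counter is concerned or uses another letter. -/
noncomputable def gameCode (M : DFA (CounterOp Bool) (Fin m)) (j : ℕ) : OCACode where
  maxState := 3 + m + j
  numLetters := 8
  trans := (0, true, 6, 0, 3 + m + j) ::
    ((List.range j).map (fun i => (3 + m + i + 1, false, 0, 1, 3 + m + i)) ++
    ((List.range j).map (fun i => (3 + m + i + 1, true, 0, 1, 3 + m + i)) ++
    (finite_fixedTrans M).toFinset.toList))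
  init := 0
  final := 2 :: (M.accept.toFinite.toFinset.toList.map fun s => 3 + (s : ℕ))

theorem mem_trans_gameCode (M : DFA (CounterOp Bool) (Fin m)) (j : ℕ)
    (t : ℕ × Bool × ℕ × SignType × ℕ) :
    t ∈ (gameCode M j).trans ↔ t = (0, true, 6, 0, 3 + m + j) ∨
      (∃ i < j, ∃ z, t = (3 + m + i + 1, z, 0, 1, 3 + m + i)) ∨ FixedTrans M t := by
  simp only [gameCode, List.mem_cons, List.mem_append, List.mem_map, List.mem_range,
    Finset.mem_toList, Set.Finite.mem_toFinset, Bool.exists_bool, Set.mem_ofPred_eq, ← or_assoc]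
  simp only [and_or_left, exists_or, eq_comm (a := t), or_assoc]

variable (M : DFA (CounterOp Bool) (Fin m)) (j : ℕ)

/-- The automaton described by `gameCode M j`. -/
noncomputable abbrev gameOCA : OCA (Fin (3 + m + j + 1)) (Fin 8) := (gameCode M j).toOCA

theorem gameOCA_step_iff (c c' : Fin (3 + m + j + 1) × ℕ) (l : Fin 8) :
    (gameOCA M j).Step c l c' ↔ ∃ d : SignType,
      ((c.1 : ℕ), decide (c.2 = 0), (l : ℕ), d, (c'.1 : ℕ)) ∈ (gameCode M j).trans ∧
        (c'.2 : ℤ) = (c.2 : ℤ) + (d : ℤ) := Iff.rfl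

theorem mem_final_gameOCA (q : Fin (3 + m + j + 1)) :
    q ∈ (gameOCA M j).final ↔ (q : ℕ) = 2 ∨ ∃ s ∈ M.accept, (q : ℕ) = 3 + (s : ℕ) := by
  change (q : ℕ) ∈ (gameCode M j).final ↔ _
  simp [gameCode, eq_comm]

variable {M j} {c c' : Fin (3 + m + j + 1) × ℕ} {l : Fin 8}

theorem gameOCA_step_init (hc : (c.1 : ℕ) = 0) (hc2 : c.2 = 0) :
    (gameOCA M j).Step c l c' ↔
      l = 6 ∧ c'.2 = 0 ∧ ((c'.1 : ℕ) = 1 ∨ (c'.1 : ℕ) = 3 + m + j) := by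
  rw [gameOCA_step_iff]
  simp only [mem_trans_gameCode, hc, hc2]
  constructor
  · rintro ⟨d, h | ⟨i, hi, z, h⟩ | h, hd⟩
    · simp only [Prod.mk.injEq] at h
      obtain ⟨-, -, h1, rfl, h2⟩ := h
      exact ⟨Fin.ext h1, by simpa using hd, .inr h2⟩
    · simp only [Prod.mk.injEq] at h
      omega
    · generalize ht : ((0 : ℕ), _, (l : ℕ), d, (c'.1 : ℕ)) = t at h
      cases h <;> simp only [Prod.mk.injEq] at ht
      case choose =>
        obtain ⟨-, -, h1, rfl, h2⟩ := ht
        exact ⟨Fin.ext h1, by simpa using hd, .inl h2⟩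
      all_goals omega
  · rintro ⟨rfl, h1, h2⟩
    refine ⟨0, ?_, by simp [h1]⟩
    rcases h2 with h2 | h2
    · rw [h2]
      exact .inr (.inr .choose)
    · rw [h2]
      exact .inl rfl

theorem gameOCA_step_one (hc : (c.1 : ℕ) = 1) :
    (gameOCA M j).Step c l c' ↔
      ((c'.1 : ℕ) = 1 ∧ ∃ a, letter a = l ∧ a.Track true c.2 c'.2) ∨
      ((c'.1 : ℕ) = 2 ∧ c'.2 = c.2 ∧ ¬ ∃ a, letter a = l ∧ ∃ t, a.Track true c.2 t) := by
  rw [gameOCA_step_iff]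
  simp only [mem_trans_gameCode, hc]
  constructor
  · rintro ⟨d, h | ⟨i, hi, z, h⟩ | h, hd⟩
    · simp at h
    · simp only [Prod.mk.injEq] at h
      omega
    · generalize ht : ((1 : ℕ), decide (c.2 = 0), (l : ℕ), d, (c'.1 : ℕ)) = t at h
      cases h <;> simp only [Prod.mk.injEq] at ht
      case track a z d' h =>
        obtain ⟨-, rfl, h1, rfl, h2⟩ := ht
        exact .inl ⟨h2, a, (Fin.ext h1).symm, (track_iff_allows _ _ _ _).2 ⟨d, h, hd⟩⟩
      case error a z h =>
        obtain ⟨-, rfl, h1, rfl, h2⟩ := ht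
        refine .inr ⟨h2, by simpa using hd, ?_⟩
        rintro ⟨b, h3, t, h4⟩
        obtain rfl := letter_injective (h3.trans (Fin.ext h1))
        obtain ⟨d, h5, -⟩ := (track_iff_allows _ _ _ _).1 h4
        exact h d h5
      case other z l' h =>
        obtain ⟨-, rfl, h1, rfl, h2⟩ := ht
        refine .inr ⟨h2, by simpa using hd, ?_⟩
        rintro ⟨b, rfl, -⟩
        have := letter_lt b
        omega
      all_goals omega
  · rintro (⟨h1, a, rfl, h2⟩ | ⟨h1, h2, h3⟩)
    · obtain ⟨d, h3, h4⟩ := (track_iff_allows _ _ _ _).1 h2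
      rw [h1]
      exact ⟨d, .inr (.inr (.track h3)), h4⟩
    · rw [h1]
      refine ⟨0, .inr (.inr ?_), by simp [h2]⟩
      by_cases hl : (l : ℕ) < 6
      · obtain ⟨a, rfl⟩ := exists_letter_eq hl
        exact .error fun d hd => h3 ⟨a, rfl, hd.exists_track⟩
      · exact .other _ (not_lt.1 hl)

theorem gameOCA_step_two (hc : (c.1 : ℕ) = 2) : (gameOCA M j).Step c l c' ↔ c' = c := by
  rw [gameOCA_step_iff]
  simp only [mem_trans_gameCode, hc]
  constructor
  · rintro ⟨d, h | ⟨i, hi, z, h⟩ | h, hd⟩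
    · simp at h
    · simp only [Prod.mk.injEq] at h
      omega
    · generalize ht : ((2 : ℕ), decide (c.2 = 0), (l : ℕ), d, (c'.1 : ℕ)) = t at h
      cases h <;> simp only [Prod.mk.injEq] at ht
      case sink z l' =>
        obtain ⟨-, -, -, rfl, h2⟩ := ht
        exact Prod.ext (Fin.ext (by omega)) (by simpa using hd)
      all_goals omega
  · rintro rfl
    rw [hc]
    exact ⟨0, .inr (.inr (.sink _ _)), by simp⟩

theorem gameOCA_step_control {s : ℕ} (hc : (c.1 : ℕ) = 3 + s) :
    (gameOCA M j).Step c l c' ↔ ∃ a s', letter a = l ∧ (c'.1 : ℕ) = 3 + s' ∧ Edge M s a s' ∧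
      a.Track false c.2 c'.2 := by
  have hs : s ≤ m + j := by have := c.1.isLt; omega
  rw [gameOCA_step_iff]
  simp only [mem_trans_gameCode, hc]
  constructor
  · rintro ⟨d, h | ⟨i, hi, z, h⟩ | h, hd⟩
    · simp at h
    · simp only [Prod.mk.injEq] at h
      obtain ⟨h1, -, h2, rfl, h3⟩ := h
      refine ⟨inc false, m + i, (Fin.ext h2).symm, by omega, ?_, ?_⟩
      · rw [show s = m + i + 1 by omega]
        exact .load i
      · simp only [Track, Pi.single_eq_same]
        simp at hd
        omega
    · generalize ht : (3 + s, decide (c.2 = 0), (l : ℕ), d, (c'.1 : ℕ)) = t at h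
      cases h <;> simp only [Prod.mk.injEq] at ht
      case move a z d' r h =>
        obtain ⟨h1, rfl, h2, rfl, h3⟩ := ht
        refine ⟨a, _, (Fin.ext h2).symm, h3, ?_, (track_iff_allows _ _ _ _).2 ⟨d, h, hd⟩⟩
        rw [show s = r by omega]
        exact .move r a
      case enter z =>
        obtain ⟨h1, -, h2, rfl, h3⟩ := ht
        refine ⟨inc false, _, (Fin.ext h2).symm, h3, ?_, ?_⟩
        · rw [show s = m by omega]
          exact .enter
        · simp only [Track, Pi.single_eq_same]
          simp at hd
          omega
      all_goals omega
  · rintro ⟨a, s', rfl, h1, h2, h3⟩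
    obtain ⟨d, h4, h5⟩ := (track_iff_allows _ _ _ _).1 h3
    rw [h1]
    refine ⟨d, ?_, h5⟩
    cases h2 with
    | move r a => exact .inr (.inr (.move r h4))
    | enter =>
      obtain rfl : d = 1 := h4
      exact .inr (.inr (.enter _))
    | load i =>
      obtain rfl : d = 1 := h4
      exact .inr (.inl ⟨i, by omega, _, by simp only [letter, add_assoc]; rfl⟩)

theorem gameOCA_run_control {w : List (Fin 8)} {s : ℕ} (hc : (c.1 : ℕ) = 3 + s) :
    (gameOCA M j).Run c w c' → ∃ v s', v.map letter = w ∧ (c'.1 : ℕ) = 3 + s' ∧ Path M v s s' ∧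
      TrackWord false v c.2 c'.2 := by
  intro h
  induction h generalizing s with
  | nil c => exact ⟨[], s, rfl, hc, rfl, rfl⟩
  | cons h1 _ ih =>
    obtain ⟨a, r, rfl, h2, h3, h4⟩ := (gameOCA_step_control hc).1 h1
    obtain ⟨v, s', rfl, h5, h6, h7⟩ := ih h2
    exact ⟨a :: v, s', rfl, h5, ⟨r, h3, h6⟩, _, h4, h7⟩

theorem Edge.le {s s' : ℕ} {a : CounterOp Bool} (h : Edge M s a s') (hs : s ≤ m + j) :
    s' ≤ m + j := by
  cases h <;> omega

theorem gameOCA_exists_run_control {v : List (CounterOp Bool)} {s s' t : ℕ}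
    (hc : (c.1 : ℕ) = 3 + s) (hv : Path M v s s') (ht : TrackWord false v c.2 t) :
    ∃ c', (gameOCA M j).Run c (v.map letter) c' ∧ (c'.1 : ℕ) = 3 + s' := by
  induction v generalizing s c with
  | nil =>
    obtain rfl : s = s' := hv
    exact ⟨c, .nil c, hc⟩
  | cons a v ih =>
    obtain ⟨r, h1, h2⟩ := hv
    obtain ⟨n, h3, h4⟩ := ht
    have hr : r ≤ m + j := h1.le (by have := c.1.isLt; omega)
    have hc' : ((⟨3 + r, by omega⟩, n) : Fin (3 + m + j + 1) × ℕ).1.val = 3 + r := rfl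
    obtain ⟨c', h5, h6⟩ := ih hc' h2 h4
    exact ⟨c', .cons ((gameOCA_step_control hc).2 ⟨a, r, rfl, rfl, h1, h3⟩) h5, h6⟩

/-- State 1 is deterministic, and its error transitions exist only where the operation is impossible
on the second counter. -/
theorem gameOCA_run_one {v : List (CounterOp Bool)} {t : ℕ} (hc : (c.1 : ℕ) = 1)
    (ht : TrackWord true v c.2 t) (h : (gameOCA M j).Run c (v.map letter) c') :
    (c'.1 : ℕ) = 1 := by
  induction v generalizing c with
  | nil => cases h; exact hc
  | cons a v ih =>
    obtain ⟨n, h1, h2⟩ := ht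
    cases h with
    | @cons _ d _ _ _ h3 h4 =>
      rcases (gameOCA_step_one hc).1 h3 with ⟨h5, b, hb, h6⟩ | ⟨-, -, h5⟩
      · obtain rfl := letter_injective hb
        obtain rfl := h1.unique h6
        exact ih h5 h2 h4
      · exact (h5 ⟨a, rfl, _, h1⟩).elim

theorem exec_load_iff (n : ℕ) (u : List (CounterOp Bool)) (d : Bool → ℕ) :
    Exec (List.replicate n (inc false) ++ u) 0 d ↔ Exec u (Pi.single false n) d := by
  simp [exec_append, exec_replicate_inc]

theorem mem_language_gameOCA {v : List (CounterOp Bool)} {u : List (CounterOp Bool)} {t : ℕ}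
    (hv : v = List.replicate (j + 1) (inc false) ++ u) (hu : u ∈ M.accepts)
    (ht : TrackWord false v 0 t) : 6 :: v.map letter ∈ (gameOCA M j).language := by
  have hc : (((⟨3 + m + j, by omega⟩, 0) : Fin (3 + m + j + 1) × ℕ).1 : ℕ) = 3 + (m + j) :=
    add_assoc _ _ _
  obtain ⟨c', h1, h2⟩ := gameOCA_exists_run_control hc ((path_load M v j (M.eval u)).2 ⟨u, hv, rfl⟩)
    ht
  exact ⟨c', .cons ((gameOCA_step_init rfl rfl).2 ⟨rfl, rfl, .inr rfl⟩) h1,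
    (mem_final_gameOCA _ _ _).2 (.inr ⟨_, hu, h2⟩)⟩

/-! ### The letter game on this automaton. -/

theorem consistent_final {Q A : Type} {N : OCA Q A} {σ : OCA.Strategy Q A} (hσ : N.IsResolver σ)
    {c : Q × ℕ} {w : List A} (h : N.Consistent σ c w) (hw : w ≠ []) (hL : w ∈ N.language) :
    c.1 ∈ N.final := by
  cases h with
  | init => exact (hw rfl).elim
  | step a h1 h2 => exact (hσ _ _ a h1).2.2 h2 hL

theorem consistent_one {σ : OCA.Strategy (Fin (3 + m + j + 1)) (Fin 8)}
    (hσ : (gameOCA M j).IsResolver σ) {w : List (Fin 8)} {v : List (CounterOp Bool)} {t : ℕ}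
    (hc : (c.1 : ℕ) = 1) (h : (gameOCA M j).Consistent σ c w) (ht : TrackWord true v c.2 t) :
    ∃ c', (gameOCA M j).Consistent σ c' (w ++ v.map letter) ∧ (c'.1 : ℕ) = 1 := by
  induction v generalizing c w with
  | nil => exact ⟨c, by simpa using h, hc⟩
  | cons a v ih =>
    obtain ⟨n, h1, h2⟩ := ht
    have hs : (gameOCA M j).Step c (letter a) (σ c w (letter a)) := by
      refine (hσ c w (letter a) h).1 ⟨(⟨1, by omega⟩, n), ?_⟩
      exact (gameOCA_step_one hc).2 (.inl ⟨rfl, a, rfl, h1⟩)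
    have hcons := OCA.Consistent.step (letter a) h hs
    rcases (gameOCA_step_one hc).1 hs with ⟨h5, b, hb, h6⟩ | ⟨-, -, h5⟩
    · obtain rfl := letter_injective hb
      rw [h1.unique h6] at h2
      simpa using ih h5 hcons h2
    · exact (h5 ⟨a, rfl, _, h1⟩).elim

theorem not_historyDeterministic_gameOCA {u : List (CounterOp Bool)} {d : Bool → ℕ}
    (hu : u ∈ M.accepts) (hd : Exec u (Pi.single false (j + 1)) d) :
    ¬ (gameOCA M j).HistoryDeterministic := by
  rintro ⟨σ, hσ⟩
  have hv := (exec_iff_trackWord _ _ _).1 ((exec_load_iff _ _ _).2 hd)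
  have h0 : (gameOCA M j).Consistent σ (0, 0) [] := .init
  have hone : (1 : ℕ) < 3 + m + j + 1 := by omega
  have htwo : (2 : ℕ) < 3 + m + j + 1 := by omega
  have hs : (gameOCA M j).Step (0, 0) 6 (σ (0, 0) [] 6) :=
    (hσ _ _ 6 h0).1 ⟨(⟨1, hone⟩, 0), (gameOCA_step_init rfl rfl).2 ⟨rfl, rfl, .inl rfl⟩⟩
  have h1 := OCA.Consistent.step 6 h0 hs
  -- If Eve goes to state 1, Adam spells the execution: she stays in state 1, not final, while the
  -- control accepts the word. If she goes to the control, Adam plays 7.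
  obtain ⟨-, h2, h3 | h3⟩ := (gameOCA_step_init rfl rfl).1 hs
  · have ht := hv true
    rw [Pi.zero_apply, ← h2] at ht
    obtain ⟨c', h4, h5⟩ := consistent_one hσ h3 h1 ht
    have := consistent_final hσ h4 (by simp) (mem_language_gameOCA rfl hu (hv false))
    rw [mem_final_gameOCA] at this
    omega
  · refine (hσ _ _ 7 h1).2.1 ?_ ⟨[], (⟨2, htwo⟩, 0), ?_, (mem_final_gameOCA _ _ _).2 (.inl rfl)⟩
    · rintro ⟨c', h⟩
      obtain ⟨a, -, h4, -⟩ := (gameOCA_step_control (h3.trans (add_assoc _ _ _))).1 h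
      have := letter_lt a
      rw [h4] at this
      exact absurd this (by decide)
    · refine .cons ((gameOCA_step_init (c' := (⟨1, hone⟩, 0)) rfl rfl).2 ⟨rfl, rfl, .inl rfl⟩)
        (.cons ((gameOCA_step_one (c' := (⟨2, htwo⟩, 0)) rfl).2 (.inr ⟨rfl, rfl, ?_⟩)) (.nil _))
      rintro ⟨a, h4, -⟩
      have := letter_lt a
      rw [h4] at this
      exact absurd this (by decide)

theorem trackWord_append_singleton {ι : Type} [DecidableEq ι] {i : ι} {v : List (CounterOp ι)}
    {a : CounterOp ι} {t s r : ℕ} (h : TrackWord i v t s) (ha : a.Track i s r) :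
    TrackWord i (v ++ [a]) t r := by
  induction v generalizing t with
  | nil => obtain rfl : t = s := h; exact ⟨r, ha, rfl⟩
  | cons b v ih =>
    obtain ⟨n, h1, h2⟩ := h
    exact ⟨n, h1, ih h2⟩

open Classical in
/-- The strategy that moves to the state `1` first. -/
noncomputable def toOne (M : DFA (CounterOp Bool) (Fin m)) (j : ℕ) :
    OCA.Strategy (Fin (3 + m + j + 1)) (Fin 8) := fun c _ l =>
  if (c.1 : ℕ) = 0 then (⟨1, by omega⟩, 0)
  else if h : ∃ c', (gameOCA M j).Step c l c' then h.choose else c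

/-- As long as the play is in state 1, its history after the letter 6 is executable on the second
counter, whose value is that of the automaton. -/
theorem toOne_invariant {w : List (Fin 8)} (h : (gameOCA M j).Consistent (toOne M j) c w) :
    (c = (0, 0) ∧ w = []) ∨ ∃ w', w = 6 :: w' ∧ ((c.1 : ℕ) = 2 ∨ (c.1 : ℕ) = 1 ∧
      ∃ v, v.map letter = w' ∧ TrackWord true v 0 c.2) := by
  induction h with
  | init => exact .inl ⟨rfl, rfl⟩
  | @step c w l _ hs ih =>
    right
    rcases ih with ⟨rfl, rfl⟩ | ⟨w', rfl, hc | ⟨hc, v, rfl, hv⟩⟩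
    · obtain ⟨rfl, -, -⟩ := (gameOCA_step_init rfl rfl).1 hs
      exact ⟨[], rfl, .inr ⟨by simp [toOne], [], rfl, by simp [toOne, TrackWord]⟩⟩
    · rw [(gameOCA_step_two hc).1 hs]
      exact ⟨w' ++ [l], rfl, .inl hc⟩
    · refine ⟨v.map letter ++ [l], rfl, ?_⟩
      rcases (gameOCA_step_one hc).1 hs with ⟨h1, a, rfl, h2⟩ | ⟨h1, -⟩
      · exact .inr ⟨h1, v ++ [a], by simp, trackWord_append_singleton hv h2⟩
      · exact .inl h1

theorem exists_step_of_ne_zero (hc : (c.1 : ℕ) = 1 ∨ (c.1 : ℕ) = 2) (l : Fin 8) :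
    ∃ c', (gameOCA M j).Step c l c' := by
  rcases hc with hc | hc
  · by_cases h : ∃ a, letter a = l ∧ ∃ t, a.Track true c.2 t
    · obtain ⟨a, rfl, t, h⟩ := h
      exact ⟨(⟨1, by omega⟩, t), (gameOCA_step_one hc).2 (.inl ⟨rfl, a, rfl, h⟩)⟩
    · exact ⟨(⟨2, by omega⟩, c.2), (gameOCA_step_one hc).2 (.inr ⟨rfl, rfl, h⟩)⟩
  · exact ⟨c, (gameOCA_step_two hc).2 rfl⟩

theorem historyDeterministic_gameOCA
    (hM : ∀ u ∈ M.accepts, ∀ d, ¬ Exec u (Pi.single false (j + 1)) d) :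
    (gameOCA M j).HistoryDeterministic := by
  refine ⟨toOne M j, fun c w l h => ⟨?_, ?_, ?_⟩⟩
  · intro hs
    rcases toOne_invariant h with ⟨rfl, rfl⟩ | ⟨w', rfl, hc⟩
    · obtain ⟨c', hs⟩ := hs
      obtain ⟨rfl, -, -⟩ := (gameOCA_step_init rfl rfl).1 hs
      exact (gameOCA_step_init rfl rfl).2 ⟨rfl, by simp [toOne], .inl (by simp [toOne])⟩
    · have h0 : ¬ (c.1 : ℕ) = 0 := by omega
      rw [toOne, if_neg h0, dif_pos hs]
      exact hs.choose_spec
  · rintro hs ⟨v, c', hr, -⟩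
    rcases toOne_invariant h with ⟨rfl, rfl⟩ | ⟨w', rfl, hc⟩
    · cases hr with
      | cons h1 _ => exact hs ⟨_, h1⟩
    · exact hs (exists_step_of_ne_zero (by omega) l)
  · rintro hs ⟨c', hr, hf⟩
    rw [mem_final_gameOCA]
    rcases toOne_invariant (h.step l hs) with ⟨-, h1⟩ | ⟨w', h1, h2 | ⟨h2, v, rfl, hv⟩⟩
    · simp at h1
    · exact .inl h2
    -- The play is in state 1 while some run accepts the word. By determinism that run does not pass
    -- through state 1, so it passes through the control.
    · exfalso
      rw [h1] at hr
      cases hr with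
      | @cons _ e _ _ _ h3 h4 =>
        obtain ⟨-, h5, h6 | h6⟩ := (gameOCA_step_init rfl rfl).1 h3
        · rw [← h5] at hv
          have := gameOCA_run_one h6 hv h4
          rw [mem_final_gameOCA] at hf
          omega
        · obtain ⟨v', s', h7, h8, h9, h10⟩ :=
            gameOCA_run_control (h6.trans (add_assoc _ _ _)) h4
          obtain rfl := (List.map_injective_iff.2 letter_injective) h7
          rw [mem_final_gameOCA] at hf
          rcases hf with hf | ⟨s, hs, hf⟩
          · omega
          · obtain rfl : s' = s := by omega
            obtain ⟨u, rfl, rfl⟩ := (path_load M v' j s).1 h9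
            -- The final valuation takes its first counter from the accepting run in the control and
            -- its second one from Eve's play.
            refine hM u hs (fun b => if b then (toOne M j c w l).2 else c'.2) ?_
            rw [← exec_load_iff, exec_iff_trackWord]
            rintro (_ | _)
            · rw [h5] at h10
              simpa using h10
            · simpa using hv

end OCACode

/-! ### Computability of the reduction and conclusion. -/

open OCACode in
theorem primrec_gameCode {m : ℕ} (M : DFA (CounterOp Bool) (Fin m)) : Primrec (gameCode M) := by
  have h : ∀ z : Bool, Primrec fun j : ℕ => (List.range j).map fun i =>
      ((3 + m + i + 1, z, 0, 1, 3 + m + i) : ℕ × Bool × ℕ × SignType × ℕ) := by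
    intro z
    have hi : Primrec fun p : ℕ × ℕ => 3 + m + p.2 :=
      Primrec.nat_add.comp (.const _) .snd
    have hg : Primrec fun p : ℕ × ℕ =>
        ((3 + m + p.2 + 1, z, 0, 1, 3 + m + p.2) : ℕ × Bool × ℕ × SignType × ℕ) :=
      (Primrec.succ.comp hi).pair ((Primrec.const z).pair ((Primrec.const 0).pair
        ((Primrec.const 1).pair hi)))
    exact Primrec.list_map Primrec.list_range hg.to₂
  have hj : Primrec fun j : ℕ => 3 + m + j := Primrec.nat_add.comp (.const _) .id
  have key : Primrec fun j => equivProd (gameCode M j) := by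
    refine hj.pair ((Primrec.const 8).pair (Primrec.pair ?_ ((Primrec.const 0).pair
      (Primrec.const _))))
    refine Primrec.list_cons.comp ?_ (Primrec.list_append.comp (h _)
      (Primrec.list_append.comp (h _) (.const _)))
    exact (Primrec.const 0).pair ((Primrec.const true).pair ((Primrec.const 6).pair
      ((Primrec.const 0).pair hj)))
  exact (Primrec.of_equiv_symm.comp key).of_eq fun j => equivProd.symm_apply_apply _

theorem primrec_const_pow (b : ℕ) : Primrec fun n : ℕ => b ^ n := by
  refine (Primrec.nat_rec₁ 1 (Primrec.nat_mul.comp .snd (.const b)).to₂).of_eq fun n => ?_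
  induction n with
  | zero => rfl
  | succ n ih => rw [pow_succ, ← ih]

/-- The words that match a regular expression are those accepted by some deterministic automaton
with states `0, …, m - 1`. -/
theorem RegularExpression.exists_dfa_fin {α : Type} (P : RegularExpression α) :
    ∃ (m : ℕ) (M : DFA α (Fin m)), M.accepts = P.matches' := by
  obtain ⟨σ, _, M, hM⟩ := P.isRegular_matches'
  exact ⟨_, M.reindex (Fintype.equivFin σ), by rw [DFA.accepts_reindex, hM]⟩

theorem mainTheorem5 :
    ¬ ComputablePred (fun d : OCACode => d.toOCA.HistoryDeterministic) := by
  intro h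
  obtain ⟨b, P, hb, hP⟩ := RegularExpression.exists_two_counter_program_halting
  obtain ⟨m, M, hM⟩ := P.exists_dfa_fin
  have hf : Computable fun c : Nat.Partrec.Code =>
      OCACode.gameCode M (b ^ Encodable.encode c - 1) :=
    ((primrec_gameCode M).comp (Primrec.nat_sub.comp
      ((primrec_const_pow b).comp Primrec.encode) (.const 1))).to_comp
  have hred : (fun c : Nat.Partrec.Code => ¬ (c.eval 0).Dom) ≤₀
      fun d : OCACode => d.toOCA.HistoryDeterministic := by
    refine ⟨_, hf, fun c => ?_⟩
    -- The automaton loads `j + 1` units, hence the shift by one; it is harmless because `b` is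
    -- positive.
    have hj : b ^ Encodable.encode c - 1 + 1 = b ^ Encodable.encode c :=
      Nat.sub_add_cancel (Nat.pow_pos hb)
    change ¬ (c.eval 0).Dom ↔ _
    rw [← hP]
    constructor
    · intro hn
      refine OCACode.historyDeterministic_gameOCA fun u hu d hd => hn ⟨d, u, hM ▸ hu, ?_⟩
      rwa [hj] at hd
    · rintro hd ⟨d, u, hu, he⟩
      refine OCACode.not_historyDeterministic_gameOCA (d := d) (hM.symm ▸ hu) ?_ hd
      rwa [hj]
  have h1 := (ComputablePred.computable_of_manyOneReducible hred h).not
  exact ComputablePred.halting_problem 0 (h1.of_eq fun c => not_not)
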